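/- All manifolds are finite-dimensional, Hausdorff and without boundary, and smooth means $C^\infty$. **Lie algebroids.** Let $\tau\colon E\to Q$ be a smooth real vector bundle of finite rank with a Lie algebroid structure $([\![\cdot,\cdot]\!],\rho)$: $\rho\colon E\to TQ$ is a smooth vector bundle map over $\mathrm{id}_Q$, and $[\![\cdot,\cdot]\!]$ is a Lie bracket on the real vector space of smooth sections of $E$ with $[\![\sigma,f\tau]\!]=f[\![\sigma,\tau]\!]+(\rho(\sigma)f)\,\tau$ for all smooth functions $f$ on $Q$. **Prolongations.** For $P=E\times\mathbb R$ or $P=E^*\times\mathbb R$, let $\pi\colon P\to Q$ be the projection. The prolongation $\mathcal T^EP\to P$ is the vector bundle with fibres $$\mathcal T^E_pP=\{(a,v)\in E_{\pi(p)}\times T_pP:\ \rho(a)=T_p\pi(v)\}.$$ It is a Lie algebroid with anchor $(a,v)\mapsto v$ and the following bracket. If $(e_\alpha)$ is a local frame of $E$, $[\![e_\alpha,e_\beta]\!]=C^\gamma_{\alpha\beta}e_\gamma$, and $Z=(a^\alpha\,(e_\alpha\circ\pi),X)$ and $Z'=(b^\alpha\,(e_\alpha\circ\pi),Y)$ are smooth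 local sections, where $a^\alpha,b^\alpha$ are functions on $P$ and $X,Y$ are vector fields on $P$, then $$[\![Z,Z']\!]=\bigl((X(b^\gamma)-Y(a^\gamma)+a^\alpha b^\beta\,(C^\gamma_{\alpha\beta}\circ\pi))\,(e_\gamma\circ\pi),\ [X,Y]\bigr).$$ A $k$-form on $\mathcal T^EP$ is a section of $\Lambda^k(\mathcal T^EP)^*$. Its exterior derivative ${\rm d}={\rm d}^{\mathcal T^EP}$ is given on smooth local sections $Z_i=(\cdot,X_i)$ by $${\rm d}\mu(Z_0,\dots,Z_k)=\sum_i(-1)^iX_i\bigl(\mu(\dots,\widehat{Z_i},\dots)\bigr)+\sum_{i<j}(-1)^{i+j}\mu([\![Z_i,Z_j]\!],\dots,\widehat{Z_i},\dots,\widehat{Z_j},\dots).$$ A smooth vector bundle map $(\Phi,f)$ between two prolongations is a *Lie algebroid morphism* if $(\Phi,f)^*({\rm d}\mu)={\rm d}\bigl((\Phi,f)^*\mu\bigr)$ for every smooth $k$-form $\mu$ on the target and every $k\ge0$. **The Legendre map.** Let $L\colon E\times\mathbb R\to\mathbb R$ be a smooth function (the Lagrangian). It is *regular* if at every point the matrix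 $\bigl(\partial^2L/\partial y^\alpha\partial y^\beta\bigr)$ of second derivatives in linear fibre coordinates $(y^\alpha)$ of $E$ is non-singular. Put $$\mathrm{Leg}_L\colon E\times\mathbb R\to E^*\times\mathbb R,\qquad \mathrm{Leg}_L(b,s)=(\mu(b,s),s),\qquad \mu(b,s)(a)=\frac{d}{dt}\Big|_{t=0}L(b+ta,s)\quad(a,b\in E_q),$$ $$\mathcal T^E\mathrm{Leg}_L\colon\mathcal T^E(E\times\mathbb R)\to\mathcal T^E(E^*\times\mathbb R),\qquad \mathcal T^E\mathrm{Leg}_L(a,v)=(a,T\mathrm{Leg}_L(v)).$$ **Contact sections.** On both prolongations let $\mathcal V^s(a,v)=v(s)$, where $s$ is the coordinate on $\mathbb R$. On $\mathcal T^E(E\times\mathbb R)$ let $S(a,v)=(0,a^V)$ at $(b,s)$, where $a^V$ is the velocity at $t=0$ of $t\mapsto(b+ta,s)$, let $\Theta_L(a,v)=({\rm d}L)(S(a,v))=a^V(L)$, and let $\eta_L=\mathcal V^s-\Theta_L$. On $\mathcal T^E(E^*\times\mathbb R)$ let $\Theta(a,v)=\nu(a)$ at $(\nu,s)$, and let $\eta=\mathcal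 V^s-\Theta$. **Theorem.** Let $L\colon E\times\mathbb R\to\mathbb R$ be a regular Lagrangian. Then the pair $(\mathcal T^E\mathrm{Leg}_L,\mathrm{Leg}_L)$ is a Lie algebroid morphism from $\mathcal T^E(E\times\mathbb R)$ to $\mathcal T^E(E^*\times\mathbb R)$. Moreover, $$(\mathcal T^E\mathrm{Leg}_L,\mathrm{Leg}_L)^*\eta=\eta_L,\qquad(\mathcal T^E\mathrm{Leg}_L,\mathrm{Leg}_L)^*\bigl({\rm d}^{\mathcal T^E(E^*\times\mathbb R)}\eta\bigr)={\rm d}^{\mathcal T^E(E\times\mathbb R)}\eta_L.$$ -/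

import Mathlib

open Bundle Set
open scoped Manifold ContDiff Topology Bundle

noncomputable section


section
variable {EQ : Type*} [NormedAddCommGroup EQ] [NormedSpace ℝ EQ]
  {Q : Type*} [TopologicalSpace Q] [ChartedSpace EQ Q]
  {F : Type*} [NormedAddCommGroup F] [NormedSpace ℝ F]
  {V : Q → Type*} [TopologicalSpace (TotalSpace F V)] [∀ q, AddCommGroup (V q)]
  [∀ q, Module ℝ (V q)] [∀ q, TopologicalSpace (V q)] [FiberBundle F V] [VectorBundle ℝ F V]

/-- The derivative `v(f)` of a real function `f` at `p` in the direction of a tangent vector `v`,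
as a linear function of `v`. -/
def dirDeriv {EP : Type*} [NormedAddCommGroup EP] [NormedSpace ℝ EP]
    {HP : Type*} [TopologicalSpace HP] (J : ModelWithCorners ℝ EP HP)
    {P : Type*} [TopologicalSpace P] [ChartedSpace HP P] (f : P → ℝ) (p : P) :
    TangentSpace J p →ₗ[ℝ] ℝ where
  toFun v := mfderiv J 𝓘(ℝ, ℝ) f p v
  map_add' v w := ContinuousLinearMap.map_add (mfderiv J 𝓘(ℝ, ℝ) f p) v w
  map_smul' c v := ContinuousLinearMap.map_smul (mfderiv J 𝓘(ℝ, ℝ) f p) c v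

/-- The product `f • σ` of a smooth function and a smooth section. -/
def smoothFunSMul (f : C^∞⟮𝓘(ℝ, EQ), Q; ℝ⟯) (σ : Cₛ^∞⟮𝓘(ℝ, EQ); F, V⟯) :
    Cₛ^∞⟮𝓘(ℝ, EQ); F, V⟯ where
  toFun q := f q • σ q
  contMDiff_toFun := ContMDiff.smul_section f.contMDiff σ.contMDiff

variable [IsManifold 𝓘(ℝ, EQ) ∞ Q]

variable (EQ F V) in
/-- A Lie algebroid structure on the smooth vector bundle `V → Q`: a smooth anchor
`V → TQ`, linear on fibres, and a Lie bracket on the space of smooth sections satisfying the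
Leibniz rule. -/
structure LieAlgebroid where
  anchor : ∀ q : Q, V q →ₗ[ℝ] TangentSpace 𝓘(ℝ, EQ) q
  contMDiff_anchor : ContMDiff (𝓘(ℝ, EQ).prod 𝓘(ℝ, F)) 𝓘(ℝ, EQ).tangent ∞
    (fun e : TotalSpace F V ↦ (⟨e.proj, anchor e.proj e.snd⟩ : TangentBundle 𝓘(ℝ, EQ) Q))
  bracket : Cₛ^∞⟮𝓘(ℝ, EQ); F, V⟯ →ₗ[ℝ] Cₛ^∞⟮𝓘(ℝ, EQ); F, V⟯ →ₗ[ℝ] Cₛ^∞⟮𝓘(ℝ, EQ); F, V⟯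
  bracket_self : ∀ σ, bracket σ σ = 0
  jacobi : ∀ σ τ υ, bracket σ (bracket τ υ) + bracket τ (bracket υ σ)
    + bracket υ (bracket σ τ) = 0
  leibniz : ∀ (f : C^∞⟮𝓘(ℝ, EQ), Q; ℝ⟯) (σ τ : Cₛ^∞⟮𝓘(ℝ, EQ); F, V⟯) (q : Q),
    bracket σ (smoothFunSMul f τ) q =
      f q • bracket σ τ q + dirDeriv 𝓘(ℝ, EQ) f q (anchor q (σ q)) • τ q

section extend
variable [FiniteDimensional ℝ EQ] [T2Space Q]

variable (EQ F V) in
theorem exists_bump_trivializationAt (q : Q) : ∃ χ : SmoothBumpFunction 𝓘(ℝ, EQ) q,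
    tsupport χ ⊆ (trivializationAt F V q).baseSet := by
  obtain ⟨χ, -, h⟩ := (SmoothBumpFunction.nhds_basis_tsupport (I := 𝓘(ℝ, EQ)) q).mem_iff.1
    ((trivializationAt F V q).open_baseSet.mem_nhds (FiberBundle.mem_baseSet_trivializationAt' q))
  exact ⟨χ, h⟩

variable [ContMDiffVectorBundle ∞ F V 𝓘(ℝ, EQ)]

variable (EQ F) in
/-- A smooth section of `V` with value `a` at `q` which near `q` is constant in the preferred
trivialization of `V` at `q`. -/
def constSection {q : Q} (a : V q) : Cₛ^∞⟮𝓘(ℝ, EQ); F, V⟯ where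
  toFun := ⇑(exists_bump_trivializationAt EQ F V q).choose • FiberBundle.extend F a
  contMDiff_toFun := by
    set χ := (exists_bump_trivializationAt EQ F V q).choose
    have hχ := (exists_bump_trivializationAt EQ F V q).choose_spec
    refine ContMDiffOn.smul_section_of_tsupport χ.contMDiff.contMDiffOn
      (trivializationAt F V q).open_baseSet hχ ?_
    intro x hx
    rw [(trivializationAt F V q).contMDiffWithinAt_section _ hx]
    refine (contMDiffOn_const (c := (trivializationAt F V q ⟨q, a⟩).2)).congr
      (s := (trivializationAt F V q).baseSet) (fun y hy ↦ ?_) x hx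
    simp [FiberBundle.extend, hy]

end extend

namespace LieAlgebroid

variable (𝔸 : LieAlgebroid EQ F V)

section prolongation

variable {EP : Type*} [NormedAddCommGroup EP] [NormedSpace ℝ EP]
  {HP : Type*} [TopologicalSpace HP] (J : ModelWithCorners ℝ EP HP)
  {P : Type*} [TopologicalSpace P] [ChartedSpace HP P] (pr : P → Q)

/-- The fibre at `p` of the prolongation of the Lie algebroid `V` over `pr : P → Q`. -/
def Prolongation (p : P) : Submodule ℝ (V (pr p) × TangentSpace J p) :=
  LinearMap.eqLocus (𝔸.anchor (pr p) ∘ₗ LinearMap.fst ℝ (V (pr p)) (TangentSpace J p))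
    ((mfderiv J 𝓘(ℝ, EQ) pr p).toLinearMap ∘ₗ LinearMap.snd ℝ (V (pr p)) (TangentSpace J p))

variable [IsManifold J ∞ P]

/-- Smoothness on `U` of a map `σ` into the total space of the prolongation, which covers
`f : N → P`: both components of `σ` are smooth. -/
def SmoothAlongOn {EN : Type*} [NormedAddCommGroup EN] [NormedSpace ℝ EN]
    {HN : Type*} [TopologicalSpace HN] (JN : ModelWithCorners ℝ EN HN)
    {N : Type*} [TopologicalSpace N] [ChartedSpace HN N]
    (f : N → P) (σ : ∀ x : N, 𝔸.Prolongation J pr (f x)) (U : Set N) : Prop :=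
  ContMDiffOn JN (𝓘(ℝ, EQ).prod 𝓘(ℝ, F)) ∞
    (fun x ↦ (⟨pr (f x), (σ x).1.1⟩ : TotalSpace F V)) U ∧
  ContMDiffOn JN J.tangent ∞ (fun x ↦ (⟨f x, (σ x).1.2⟩ : TangentBundle J P)) U

/-- Smoothness on `U` of a section of the prolongation. -/
def SmoothSectionOn (σ : ∀ p : P, 𝔸.Prolongation J pr p) (U : Set P) : Prop :=
  𝔸.SmoothAlongOn J pr J id σ U

/-- A `k`-form on the prolongation: a section of the `k`-th exterior power of its dual. -/
abbrev ProlongationForm (k : ℕ) : Type _ := ∀ p : P, 𝔸.Prolongation J pr p [⋀^Fin k]→ₗ[ℝ] ℝ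

/-- A form is smooth if its values on local smooth sections are smooth functions. -/
def SmoothForm {k : ℕ} (μ : 𝔸.ProlongationForm J pr k) : Prop :=
  ∀ (U : Set P) (σ : Fin k → ∀ p : P, 𝔸.Prolongation J pr p), IsOpen U →
    (∀ i, 𝔸.SmoothSectionOn J pr (σ i) U) →
    ContMDiffOn J 𝓘(ℝ, ℝ) ∞ (fun p ↦ μ p (fun i ↦ σ i p)) U

variable [FiniteDimensional ℝ EQ] [T2Space Q] [ContMDiffVectorBundle ∞ F V 𝓘(ℝ, EQ)]

/-- The derivative at `p`, in the direction of a tangent vector `v` of `P`, of a section `a` of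
`V` along `pr`, with respect to the flat connection of the preferred trivialization of `V`
at `pr p`. -/
def flatDeriv (a : ∀ p : P, V (pr p)) (p : P) (v : TangentSpace J p) : V (pr p) :=
  (trivializationAt F V (pr p)).symm (pr p)
    (mfderiv J 𝓘(ℝ, F) (fun p' ↦ (trivializationAt F V (pr p) ⟨pr p', a p'⟩).2) p v)

/-- The Lie bracket of the sections `σ = (a, X)` and `τ = (b, Y)` of the prolongation, as an
element of `V (pr p) × T_p P`. If `e_α` is the frame of `V` given by the preferred
trivialization at `pr p`, `⟦e_α, e_β⟧ = C^γ_{αβ} e_γ`, `a = a^α (e_α ∘ pr)` and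
`b = b^α (e_α ∘ pr)`, then its first component is
`(X(b^γ) - Y(a^γ) + a^α b^β C^γ_{αβ}(pr p)) e_γ(pr p)`, and the second one is `[X, Y](p)`. -/
def prolongationBracketAux (σ τ : ∀ p : P, 𝔸.Prolongation J pr p) (p : P) :
    V (pr p) × TangentSpace J p :=
  (𝔸.bracket (constSection EQ F (σ p).1.1) (constSection EQ F (τ p).1.1) (pr p)
      + flatDeriv (F := F) J pr (fun p' ↦ (τ p').1.1) p (σ p).1.2
      - flatDeriv (F := F) J pr (fun p' ↦ (σ p').1.1) p (τ p).1.2,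
    VectorField.mlieBracket J (fun p' ↦ (σ p').1.2) (fun p' ↦ (τ p').1.2) p)

open Classical in
/-- The Lie bracket of sections of the prolongation. For sections which are smooth near `p` the
condition holds automatically; the value `0` is never used for them. -/
def prolongationBracket (σ τ : ∀ p : P, 𝔸.Prolongation J pr p) (p : P) :
    𝔸.Prolongation J pr p :=
  if h : 𝔸.prolongationBracketAux J pr σ τ p ∈ 𝔸.Prolongation J pr p then ⟨_, h⟩ else 0

/-- The terms with brackets in the formula for the exterior derivative of `μ` at `p`:
the sum over `i < j` of
`(-1)^(i + j) μ(⟦σ_i, σ_j⟧, σ_0, …, omit σ_i, …, omit σ_j, …, σ_k)`; the pairs `i < j` in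
`{0, …, k}` are enumerated as `(i, j + 1)` with `i ≤ j` in `{0, …, k - 1}`. -/
def bracketTerms : {k : ℕ} → 𝔸.ProlongationForm J pr k →
    (Fin (k + 1) → ∀ p : P, 𝔸.Prolongation J pr p) → P → ℝ
  | 0, _, _, _ => 0
  | k + 1, μ, σ, p => ∑ i : Fin (k + 1), ∑ j ∈ Finset.Ici i,
      (-1 : ℝ) ^ ((i : ℕ) + ((j : ℕ) + 1)) *
        μ p (Fin.cons (𝔸.prolongationBracket J pr (σ i.castSucc) (σ j.succ) p)
          (j.removeNth (i.castSucc.removeNth (fun l ↦ σ l p))))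

/-- The value of the exterior derivative of `μ` on the sections `σ_0, …, σ_k`, at `p`. -/
def koszul {k : ℕ} (μ : 𝔸.ProlongationForm J pr k)
    (σ : Fin (k + 1) → ∀ p : P, 𝔸.Prolongation J pr p) (p : P) : ℝ :=
  ∑ i : Fin (k + 1), (-1 : ℝ) ^ (i : ℕ) *
      dirDeriv J (fun p' ↦ μ p' (i.removeNth (fun l ↦ σ l p'))) p (σ i p).1.2
    + 𝔸.bracketTerms J pr μ σ p

open Classical in
/-- A section of the prolongation through `w`, smooth near `p`. -/
def sectionThrough {p : P} (w : 𝔸.Prolongation J pr p) : ∀ p' : P, 𝔸.Prolongation J pr p' :=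
  if h : ∃ σ : ∀ p' : P, 𝔸.Prolongation J pr p', σ p = w ∧
    ∃ U ∈ 𝓝 p, IsOpen U ∧ 𝔸.SmoothSectionOn J pr σ U then h.choose else fun _ ↦ 0

/-- The exterior derivative of a form on the prolongation, as a function of `k + 1` elements of
a fibre. They are extended to local smooth sections; the value does not depend on the
extensions. -/
def extDeriv {k : ℕ} (μ : 𝔸.ProlongationForm J pr k) (p : P)
    (w : Fin (k + 1) → 𝔸.Prolongation J pr p) : ℝ :=
  𝔸.koszul J pr μ (fun i ↦ 𝔸.sectionThrough J pr (w i)) p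

end prolongation

section morphism

variable {EP : Type*} [NormedAddCommGroup EP] [NormedSpace ℝ EP]
  {HP : Type*} [TopologicalSpace HP] (J : ModelWithCorners ℝ EP HP)
  {P : Type*} [TopologicalSpace P] [ChartedSpace HP P] [IsManifold J ∞ P] (pr : P → Q)
  {EP' : Type*} [NormedAddCommGroup EP'] [NormedSpace ℝ EP']
  {HP' : Type*} [TopologicalSpace HP'] (J' : ModelWithCorners ℝ EP' HP')
  {P' : Type*} [TopologicalSpace P'] [ChartedSpace HP' P'] [IsManifold J' ∞ P'] (pr' : P' → Q)

variable {J pr J' pr'} in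
/-- The pullback of a form by a fibrewise linear map covering `f : P → P'`. -/
def pullbackForm {f : P → P'}
    (Φ : ∀ p : P, 𝔸.Prolongation J pr p →ₗ[ℝ] 𝔸.Prolongation J' pr' (f p)) {k : ℕ}
    (μ : 𝔸.ProlongationForm J' pr' k) : 𝔸.ProlongationForm J pr k :=
  fun p ↦ (μ (f p)).compLinearMap (Φ p)

/-- The fibrewise linear map `Φ` covering `f : P → P'` is a morphism of Lie algebroids between
prolongations: it is a smooth morphism of vector bundles, and the pullback of smooth forms of any
degree commutes with the exterior derivatives. -/
structure IsLieAlgebroidMorphism [FiniteDimensional ℝ EQ] [T2Space Q]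
    [ContMDiffVectorBundle ∞ F V 𝓘(ℝ, EQ)] (f : P → P')
    (Φ : ∀ p : P, 𝔸.Prolongation J pr p →ₗ[ℝ] 𝔸.Prolongation J' pr' (f p)) : Prop where
  smooth_base : ContMDiff J J' ∞ f
  smooth_total : ∀ (U : Set P) (σ : ∀ p : P, 𝔸.Prolongation J pr p), IsOpen U →
    𝔸.SmoothSectionOn J pr σ U → 𝔸.SmoothAlongOn J' pr' J f (fun p ↦ Φ p (σ p)) U
  extDeriv_pullbackForm : ∀ (k : ℕ) (μ : 𝔸.ProlongationForm J' pr' k), 𝔸.SmoothForm J' pr' μ →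
    ∀ (p : P) (w : Fin (k + 1) → 𝔸.Prolongation J pr p),
      𝔸.extDeriv J pr (𝔸.pullbackForm Φ μ) p w = 𝔸.extDeriv J' pr' μ (f p) (fun i ↦ Φ p (w i))

end morphism

end LieAlgebroid
end

section contact

variable {EQ : Type*} [NormedAddCommGroup EQ] [NormedSpace ℝ EQ]
  {Q : Type*} [TopologicalSpace Q] [ChartedSpace EQ Q]
  {F : Type*} [NormedAddCommGroup F] [NormedSpace ℝ F]
  {V : Q → Type*} [TopologicalSpace (TotalSpace F V)] [∀ q, AddCommGroup (V q)]
  [∀ q, Module ℝ (V q)] [∀ q, TopologicalSpace (V q)] [FiberBundle F V] [VectorBundle ℝ F V]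

variable (EQ F) in
/-- The model of the manifold `V × ℝ`, where `V → Q` is a vector bundle with fibre `F`. -/
abbrev timesRealModel : ModelWithCorners ℝ ((EQ × F) × ℝ) (ModelProd (ModelProd EQ F) ℝ) :=
  (𝓘(ℝ, EQ).prod 𝓘(ℝ, F)).prod 𝓘(ℝ, ℝ)

variable (F V) in
/-- The projection `V × ℝ → Q`. -/
abbrev timesRealProj : TotalSpace F V × ℝ → Q := fun p ↦ p.1.proj

variable [IsManifold 𝓘(ℝ, EQ) ∞ Q] [ContMDiffVectorBundle ∞ F V 𝓘(ℝ, EQ)]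

variable (F V) in
/-- The inclusion of the fibre of `V × ℝ` over `q` at height `s`, read in the preferred
trivialization. -/
def fibreMap (q : Q) (s : ℝ) (y : F) : TotalSpace F V × ℝ :=
  (⟨q, (trivializationAt F V q).symm q y⟩, s)

theorem contMDiff_fibreMap (q : Q) (s : ℝ) :
    ContMDiff 𝓘(ℝ, F) (timesRealModel EQ F) ∞ (fibreMap F V q s) := by
  refine ContMDiff.prodMk (fun y ↦ ?_) contMDiff_const
  rw [contMDiffAt_totalSpace]
  refine ⟨contMDiffAt_const, ?_⟩
  refine contMDiffAt_id.congr_of_eventuallyEq (Filter.Eventually.of_forall fun y' ↦ ?_)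
  simp [FiberBundle.mem_baseSet_trivializationAt']

theorem fibreMap_trivializationAt (p : TotalSpace F V × ℝ) (a : V p.1.proj) (t : ℝ) :
    ((⟨p.1.proj, p.1.snd + t • a⟩, p.2) : TotalSpace F V × ℝ) =
      fibreMap F V p.1.proj p.2
        ((trivializationAt F V p.1.proj).continuousLinearEquivAt ℝ p.1.proj
            (FiberBundle.mem_baseSet_trivializationAt' p.1.proj) p.1.snd +
          t • (trivializationAt F V p.1.proj).continuousLinearEquivAt ℝ p.1.proj
            (FiberBundle.mem_baseSet_trivializationAt' p.1.proj) a) := by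
  rw [← map_smul, ← map_add, fibreMap]
  congr 2
  exact (((trivializationAt F V p.1.proj).continuousLinearEquivAt ℝ p.1.proj
            (FiberBundle.mem_baseSet_trivializationAt' p.1.proj)).symm_apply_apply _).symm


variable (EQ) in
/-- The derivative at `y` of the inclusion of the fibre, on the fibre itself. -/
def fibreMapDeriv (p : TotalSpace F V × ℝ) :
    V p.1.proj →L[ℝ] TangentSpace (timesRealModel EQ F) p :=
  let φ := (trivializationAt F V p.1.proj).continuousLinearEquivAt ℝ p.1.proj
            (FiberBundle.mem_baseSet_trivializationAt' p.1.proj)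
  (mfderiv 𝓘(ℝ, F) (timesRealModel EQ F) (fibreMap F V p.1.proj p.2) (φ p.1.snd)).comp
   (φ : V p.1.proj →L[ℝ] F)

theorem mdifferentiableAt_fibre_curve (p : TotalSpace F V × ℝ) (a : V p.1.proj) :
    MDifferentiableAt 𝓘(ℝ, ℝ) (timesRealModel EQ F)
      (fun t : ℝ ↦ ((⟨p.1.proj, p.1.snd + t • a⟩, p.2) : TotalSpace F V × ℝ)) 0 := by
  simp_rw [fibreMap_trivializationAt]
  set φ := (trivializationAt F V p.1.proj).continuousLinearEquivAt ℝ p.1.proj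
            (FiberBundle.mem_baseSet_trivializationAt' p.1.proj) with hφ
  have h1 : MDifferentiableAt 𝓘(ℝ, ℝ) 𝓘(ℝ, F) (fun t : ℝ ↦ φ p.1.snd + t • φ a) 0 :=
    ((differentiableAt_id (𝕜 := ℝ) (x := (0 : ℝ))).smul_const (φ a)).const_add _
      |>.mdifferentiableAt
  exact MDifferentiableAt.comp (0 : ℝ)
    ((contMDiff_fibreMap p.1.proj p.2).mdifferentiableAt (by simp)) h1

theorem mfderiv_fibre_curve (p : TotalSpace F V × ℝ) (a : V p.1.proj) :
    mfderiv 𝓘(ℝ, ℝ) (timesRealModel EQ F)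
      (fun t : ℝ ↦ ((⟨p.1.proj, p.1.snd + t • a⟩, p.2) : TotalSpace F V × ℝ)) 0 (1 : ℝ)
      = fibreMapDeriv EQ p a := by
  set φ := (trivializationAt F V p.1.proj).continuousLinearEquivAt ℝ p.1.proj
            (FiberBundle.mem_baseSet_trivializationAt' p.1.proj) with hφ
  have h1 : HasFDerivAt (fun t : ℝ ↦ φ p.1.snd + t • φ a)
      ((ContinuousLinearMap.id ℝ ℝ).smulRight (φ a)) 0 :=
    ((hasFDerivAt_id (𝕜 := ℝ) (0 : ℝ)).smul_const (φ a)).const_add _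
  have h2 := (((contMDiff_fibreMap (EQ := EQ) (V := V) (F := F) p.1.proj p.2).mdifferentiableAt
    (x := φ p.1.snd + (0 : ℝ) • φ a) (by simp)).hasMFDerivAt)
  have h3 := (HasMFDerivAt.comp (0 : ℝ) h2 h1.hasMFDerivAt).mfderiv
  have h4 := congrArg (fun l : ℝ →L[ℝ] ((EQ × F) × ℝ) ↦ l 1) h3
  have h5 : ∀ c : ℝ → TotalSpace F V × ℝ,
      c = fibreMap F V p.1.proj p.2 ∘ (fun t : ℝ ↦ φ p.1.snd + t • φ a) →
      (show (EQ × F) × ℝ from mfderiv 𝓘(ℝ, ℝ) (timesRealModel EQ F) c 0 (1 : ℝ)) =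
      fibreMapDeriv EQ p a := by
    rintro _ rfl
    refine h4.trans ?_
    change mfderiv 𝓘(ℝ, F) (timesRealModel EQ F) (fibreMap F V p.1.proj p.2)
        (φ p.1.snd + (0 : ℝ) • φ a) ((1 : ℝ) • φ a) =
      mfderiv 𝓘(ℝ, F) (timesRealModel EQ F) (fibreMap F V p.1.proj p.2)
        (φ p.1.snd) (φ a)
    rw [zero_smul, add_zero, one_smul]
  exact h5 _ (funext fun t ↦ fibreMap_trivializationAt p a t)

variable (EQ) in
/-- The vertical lift of `a` at `p = (b, s)`: the velocity at `t = 0` of the curve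
`t ↦ (b + t a, s)`. -/
def verticalLift (p : TotalSpace F V × ℝ) :
    V p.1.proj →ₗ[ℝ] TangentSpace (timesRealModel EQ F) p where
  toFun a := mfderiv 𝓘(ℝ, ℝ) (timesRealModel EQ F)
    (fun t : ℝ ↦ ((⟨p.1.proj, p.1.snd + t • a⟩, p.2) : TotalSpace F V × ℝ)) 0 (1 : ℝ)
  map_add' a b := by
    rw [mfderiv_fibre_curve, mfderiv_fibre_curve, mfderiv_fibre_curve]
    exact map_add (fibreMapDeriv EQ p) a b
  map_smul' c a := by
    rw [mfderiv_fibre_curve, mfderiv_fibre_curve]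
    exact map_smul (fibreMapDeriv EQ p) c a

theorem mfderiv_timesRealProj_verticalLift (p : TotalSpace F V × ℝ) (a : V p.1.proj) :
    mfderiv (timesRealModel EQ F) 𝓘(ℝ, EQ) (timesRealProj F V) p (verticalLift EQ p a) = 0 := by
  have h1 : MDifferentiableAt (timesRealModel EQ F) 𝓘(ℝ, EQ) (timesRealProj F V)
      (⟨p.1.proj, p.1.snd + (0 : ℝ) • a⟩, p.2) :=
    ((contMDiff_proj (n := 1) V).comp contMDiff_fst).mdifferentiableAt (by simp)
  have h2 := mfderiv_comp (0 : ℝ) h1 (mdifferentiableAt_fibre_curve (EQ := EQ) p a)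
  have h3 := congrArg (fun l : ℝ →L[ℝ] EQ ↦ l 1) h2
  have h4 : mfderiv 𝓘(ℝ, ℝ) 𝓘(ℝ, EQ) (timesRealProj F V ∘
      (fun t : ℝ ↦ ((⟨p.1.proj, p.1.snd + t • a⟩, p.2) : TotalSpace F V × ℝ))) 0 = 0 :=
    mfderiv_const
  rw [h4] at h3
  have h5 : ((⟨p.1.proj, p.1.snd + (0 : ℝ) • a⟩, p.2) : TotalSpace F V × ℝ) = p := by
    rw [zero_smul, add_zero]
  have h6 : ∀ p', p' = p → ∀ v : (EQ × F) × ℝ,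
      (show EQ from mfderiv (timesRealModel EQ F) 𝓘(ℝ, EQ) (timesRealProj F V) p' v) =
      mfderiv (timesRealModel EQ F) 𝓘(ℝ, EQ) (timesRealProj F V) p v := by
    rintro _ rfl v; rfl
  exact (h6 _ h5 _).symm.trans h3.symm

variable (L : C^∞⟮timesRealModel EQ F, TotalSpace F V × ℝ; ℝ⟯)

theorem deriv_fibre_curve (p : TotalSpace F V × ℝ) (a : V p.1.proj) :
    deriv (fun t : ℝ ↦ L (⟨p.1.proj, p.1.snd + t • a⟩, p.2)) 0 =
      mfderiv (timesRealModel EQ F) 𝓘(ℝ, ℝ) L p (fibreMapDeriv EQ p a) := by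
  have h1 : MDifferentiableAt (timesRealModel EQ F) 𝓘(ℝ, ℝ) L
      (⟨p.1.proj, p.1.snd + (0 : ℝ) • a⟩, p.2) :=
    L.contMDiff.mdifferentiableAt (by simp)
  have h2 := mfderiv_comp (0 : ℝ) h1 (mdifferentiableAt_fibre_curve (EQ := EQ) p a)
  have h3 := congrArg (fun l : ℝ →L[ℝ] ℝ ↦ l 1) h2
  rw [mfderiv_eq_fderiv] at h3
  have h5 : ((⟨p.1.proj, p.1.snd + (0 : ℝ) • a⟩, p.2) : TotalSpace F V × ℝ) = p := by
    rw [zero_smul, add_zero]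
  have h6 : ∀ p', p' = p → ∀ v : (EQ × F) × ℝ,
      (show ℝ from mfderiv (timesRealModel EQ F) 𝓘(ℝ, ℝ) L p' v) =
      mfderiv (timesRealModel EQ F) 𝓘(ℝ, ℝ) L p v := by
    rintro _ rfl v; rfl
  rw [← mfderiv_fibre_curve]
  exact h3.trans (h6 _ h5 _)

/-- The fibre derivative of `L` at `p = (b, s)`, an element of the dual of the fibre:
`a ↦ d/dt|_{t = 0} L(b + t a, s)`. -/
def fibreDeriv (p : TotalSpace F V × ℝ) : V p.1.proj →L[ℝ] ℝ where
  toFun a := deriv (fun t : ℝ ↦ L (⟨p.1.proj, p.1.snd + t • a⟩, p.2)) 0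
  map_add' a b := by
    simp only [deriv_fibre_curve]
    exact map_add ((mfderiv (timesRealModel EQ F) 𝓘(ℝ, ℝ) L p).comp (fibreMapDeriv EQ p)) a b
  map_smul' c a := by
    simp only [deriv_fibre_curve]
    exact map_smul ((mfderiv (timesRealModel EQ F) 𝓘(ℝ, ℝ) L p).comp (fibreMapDeriv EQ p)) c a
  cont := by
    simp only [deriv_fibre_curve]
    exact ((mfderiv (timesRealModel EQ F) 𝓘(ℝ, ℝ) L p).comp (fibreMapDeriv EQ p)).continuous

/-- The Lagrangian `L` is regular: at every point `p = (b, s)` the matrix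
`∂²L/∂y^α∂y^β` of second derivatives along the fibre, with respect to the linear coordinates
`y^α` given by a basis of the fibre, is non-singular. -/
def IsRegularLagrangian : Prop :=
  ∀ (p : TotalSpace F V × ℝ)
    (e : Module.Basis (Fin (Module.finrank ℝ (V p.1.proj))) ℝ (V p.1.proj)),
    (Matrix.of fun α β ↦ deriv (fun t : ℝ ↦
      fibreDeriv L (⟨p.1.proj, p.1.snd + t • e α⟩, p.2) (e β)) 0).det ≠ 0

variable [∀ q, IsTopologicalAddGroup (V q)] [∀ q, ContinuousSMul ℝ (V q)]

/-- The Legendre transformation `V × ℝ → V* × ℝ` of `L`. -/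
def legendre (p : TotalSpace F V × ℝ) :
    TotalSpace (F →L[ℝ] ℝ) (fun q ↦ V q →L[ℝ] ℝ) × ℝ :=
  (⟨p.1.proj, fibreDeriv L p⟩, p.2)

theorem fderiv_trivialization_eq (e : Bundle.Trivialization F (TotalSpace.proj : TotalSpace F V → Q))
    [MemTrivializationAtlas e] (p : TotalSpace F V × ℝ) (hp : p.1.proj ∈ e.baseSet) (z : F) :
    fderiv ℝ (fun y ↦ L (⟨p.1.proj, e.symm p.1.proj y⟩, p.2)) (e p.1).2 z =
      fibreDeriv L p (e.symm p.1.proj z) := by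
  have hs : ContMDiff 𝓘(ℝ, F) 𝓘(ℝ, ℝ) ∞
      (fun y ↦ L (⟨p.1.proj, e.symm p.1.proj y⟩, p.2)) := by
    refine L.contMDiff.comp (ContMDiff.prodMk (fun y ↦ ?_) contMDiff_const)
    rw [e.contMDiffAt_iff (IB := 𝓘(ℝ, EQ)) (by simpa [e.mem_source] using hp)]
    refine ⟨contMDiffAt_const, ?_⟩
    refine contMDiffAt_id.congr_of_eventuallyEq (Filter.Eventually.of_forall fun y' ↦ ?_)
    simp [hp]
  have h1 : DifferentiableAt ℝ (fun y ↦ L (⟨p.1.proj, e.symm p.1.proj y⟩, p.2)) (e p.1).2 :=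
    (hs.contDiff.differentiable (by simp)) _
  rw [← h1.lineDeriv_eq_fderiv]
  change deriv _ 0 = deriv _ 0
  congr 1
  funext t
  have h2 : e.symm p.1.proj ((e p.1).2 + t • z) = p.1.snd + t • e.symm p.1.proj z := by
    have h3 := map_add (e.symmL ℝ p.1.proj) (e p.1).2 (t • z)
    rw [map_smul] at h3
    rw [e.symmL_apply hp, e.symmL_apply hp, e.symmL_apply hp] at h3
    rw [h3]
    congr 1
    exact e.symm_apply_apply_mk hp p.1.snd
  exact congrArg (fun b ↦ L ((⟨p.1.proj, b⟩ : TotalSpace F V), p.2)) h2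

theorem contMDiff_legendre :
    ContMDiff (timesRealModel EQ F) (timesRealModel EQ (F →L[ℝ] ℝ)) ∞ (legendre L) := by
  refine ContMDiff.prodMk (fun p ↦ ?_) contMDiff_snd
  have hproj : ContMDiff (timesRealModel EQ F) 𝓘(ℝ, EQ) ∞ (timesRealProj F V) :=
    (contMDiff_proj V).comp contMDiff_fst
  rw [contMDiffAt_hom_bundle (E₂ := fun _ ↦ ℝ)]
  refine ⟨hproj.contMDiffAt, ?_⟩
  set e := trivializationAt F V p.1.proj with he
  have hpe : p.1.proj ∈ e.baseSet := FiberBundle.mem_baseSet_trivializationAt' p.1.proj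
  have hU : ∀ᶠ x : TotalSpace F V × ℝ in 𝓝 p, x.1.proj ∈ e.baseSet :=
    hproj.continuous.continuousAt (e.open_baseSet.mem_nhds hpe)
  have hg : ContMDiffAt (timesRealModel EQ F) 𝓘(ℝ, F) ∞
      (fun x : TotalSpace F V × ℝ ↦ (e x.1).2) p :=
    ((e.contMDiffAt_iff (IB := 𝓘(ℝ, EQ)) (e.mem_source.2 hpe)).1
      (contMDiff_fst.contMDiffAt (x := p))).2
  have hf : ContMDiffAt ((timesRealModel EQ F).prod 𝓘(ℝ, F)) 𝓘(ℝ, ℝ) ∞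
      (Function.uncurry fun (x : TotalSpace F V × ℝ) (y : F) ↦
        L (⟨x.1.proj, e.symm x.1.proj y⟩, x.2)) (p, (e p.1).2) := by
    refine L.contMDiff.contMDiffAt.comp _ (ContMDiffAt.prodMk ?_
      (contMDiff_snd.comp contMDiff_fst).contMDiffAt)
    refine (e.contMDiffAt_iff (IB := 𝓘(ℝ, EQ)) (n := ∞) (x₀ := (p, (e p.1).2))
      (f := fun x : (TotalSpace F V × ℝ) × F ↦
        (⟨x.1.1.proj, e.symm x.1.1.proj x.2⟩ : TotalSpace F V)) (e.mem_source.2 hpe)).2 ?_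
    refine ⟨(hproj.comp contMDiff_fst).contMDiffAt, ?_⟩
    refine contMDiff_snd.contMDiffAt.congr_of_eventuallyEq ?_
    filter_upwards [continuous_fst.continuousAt.eventually hU] with x hx
    simp [hx]
  have h := ContMDiffAt.mfderiv (m := ∞) _ _ hf hg (by simp)
  refine h.congr_of_eventuallyEq ?_
  filter_upwards [hU] with x hx
  ext z
  simp only [inTangentCoordinates_model_space, mfderiv_eq_fderiv]
  rw [ContinuousLinearMap.inCoordinates_eq hx (by simp)]
  refine Eq.trans ?_ (fderiv_trivialization_eq L e x hx z).symm
  simp [he]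

/-- The prolonged Legendre transformation `(a, v) ↦ (a, T(Leg) v)` between the prolongations of
a Lie algebroid over `V × ℝ` and over `V* × ℝ`. -/
def prolongedLegendre (𝔸 : LieAlgebroid EQ F V) (p : TotalSpace F V × ℝ) :
    𝔸.Prolongation (timesRealModel EQ F) (timesRealProj F V) p →ₗ[ℝ]
      𝔸.Prolongation (timesRealModel EQ (F →L[ℝ] ℝ))
        (timesRealProj (F →L[ℝ] ℝ) (fun q ↦ V q →L[ℝ] ℝ)) (legendre L p) where
  toFun x := ⟨(x.1.1, mfderiv (timesRealModel EQ F) (timesRealModel EQ (F →L[ℝ] ℝ))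
      (legendre L) p x.1.2), by
    have h1 : MDifferentiableAt (timesRealModel EQ (F →L[ℝ] ℝ)) 𝓘(ℝ, EQ)
        (timesRealProj (F →L[ℝ] ℝ) (fun q ↦ V q →L[ℝ] ℝ)) (legendre L p) :=
      ((contMDiff_proj (n := 1) (fun q ↦ V q →L[ℝ] ℝ)).comp contMDiff_fst).mdifferentiableAt
        (by simp)
    have h2 := mfderiv_comp p h1 ((contMDiff_legendre L).mdifferentiableAt (by simp))
    have h3 := congrArg (fun l : ((EQ × F) × ℝ) →L[ℝ] EQ ↦ l x.1.2) h2
    have h4 : 𝔸.anchor p.1.proj x.1.1 =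
      mfderiv (timesRealModel EQ F) 𝓘(ℝ, EQ) (timesRealProj F V) p x.1.2 := x.2
    exact h4.trans h3⟩
  map_add' x y := Subtype.ext (Prod.ext rfl (ContinuousLinearMap.map_add _ _ _))
  map_smul' c x := Subtype.ext (Prod.ext rfl (ContinuousLinearMap.map_smul _ _ _))

/-- The vertical endomorphism `S(a, v) = (0, a^V)` of the prolongation over `V × ℝ`. -/
def verticalEndomorphism (𝔸 : LieAlgebroid EQ F V) (p : TotalSpace F V × ℝ) :
    𝔸.Prolongation (timesRealModel EQ F) (timesRealProj F V) p →ₗ[ℝ]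
      𝔸.Prolongation (timesRealModel EQ F) (timesRealProj F V) p where
  toFun x := ⟨(0, verticalLift EQ p x.1.1),
    (map_zero (𝔸.anchor p.1.proj)).trans (mfderiv_timesRealProj_verticalLift p x.1.1).symm⟩
  map_add' _ _ := Subtype.ext (Prod.ext (add_zero _).symm (map_add (verticalLift EQ p) _ _))
  map_smul' _ _ := Subtype.ext (Prod.ext (smul_zero _).symm (map_smul (verticalLift EQ p) _ _))

/-- The `1`-form on the prolongation given by linear functions on the fibres. -/
def LieAlgebroid.oneForm {𝔸 : LieAlgebroid EQ F V} {EP : Type*} [NormedAddCommGroup EP]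
    [NormedSpace ℝ EP] {HP : Type*} [TopologicalSpace HP] {J : ModelWithCorners ℝ EP HP}
    {P : Type*} [TopologicalSpace P] [ChartedSpace HP P] {pr : P → Q} [IsManifold J ∞ P]
    (μ : ∀ p : P, 𝔸.Prolongation J pr p →ₗ[ℝ] ℝ) : 𝔸.ProlongationForm J pr 1 :=
  fun p ↦ AlternatingMap.ofSubsingleton ℝ _ ℝ 0 (μ p)

/-- The component `v(s)` along `ℝ` of a tangent vector `v` of `V × ℝ`, as a linear form on the
prolongation: `𝒱^s(a, v) = v(s)`. -/
def sComponent (𝔸 : LieAlgebroid EQ F V) {G : Type*} [NormedAddCommGroup G] [NormedSpace ℝ G]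
    {W : Q → Type*} [TopologicalSpace (TotalSpace G W)] [∀ q, TopologicalSpace (W q)]
    [FiberBundle G W] (p : TotalSpace G W × ℝ) :
    𝔸.Prolongation (timesRealModel EQ G) (timesRealProj G W) p →ₗ[ℝ] ℝ where
  toFun x := dirDeriv (timesRealModel EQ G) (Prod.snd : TotalSpace G W × ℝ → ℝ) p x.1.2
  map_add' x y := map_add _ x.1.2 y.1.2
  map_smul' c x := map_smul _ c x.1.2

/-- The Poincaré-Cartan `1`-section `Θ_L(a, v) = ρ^π(S(a, v)) L`. -/
def poincareCartan (𝔸 : LieAlgebroid EQ F V) (p : TotalSpace F V × ℝ) :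
    𝔸.Prolongation (timesRealModel EQ F) (timesRealProj F V) p →ₗ[ℝ] ℝ where
  toFun x := dirDeriv (timesRealModel EQ F) L p (verticalEndomorphism 𝔸 p x).1.2
  map_add' x y := by
    rw [map_add]; exact map_add _ (verticalEndomorphism 𝔸 p x).1.2 _
  map_smul' c x := by
    rw [map_smul]; exact map_smul _ c (verticalEndomorphism 𝔸 p x).1.2

/-- The Lagrangian contact section `η_L = 𝒱^s - Θ_L`. -/
def lagrangianContactForm (𝔸 : LieAlgebroid EQ F V) :
    𝔸.ProlongationForm (timesRealModel EQ F) (timesRealProj F V) 1 :=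
  LieAlgebroid.oneForm fun p ↦ sComponent 𝔸 p - poincareCartan L 𝔸 p

/-- The Liouville `1`-section `Θ(a, v) = b(a)` at the point `(b, s)` of `V* × ℝ`. -/
def liouville (𝔸 : LieAlgebroid EQ F V) (p : TotalSpace (F →L[ℝ] ℝ) (fun q ↦ V q →L[ℝ] ℝ) × ℝ) :
    𝔸.Prolongation (timesRealModel EQ (F →L[ℝ] ℝ))
      (timesRealProj (F →L[ℝ] ℝ) (fun q ↦ V q →L[ℝ] ℝ)) p →ₗ[ℝ] ℝ where
  toFun x := p.1.snd x.1.1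
  map_add' _ _ := p.1.snd.map_add _ _
  map_smul' _ _ := p.1.snd.map_smul _ _

/-- The canonical contact section `η = 𝒱^s - Θ`. -/
def canonicalContactForm (𝔸 : LieAlgebroid EQ F V) :
    𝔸.ProlongationForm (timesRealModel EQ (F →L[ℝ] ℝ))
      (timesRealProj (F →L[ℝ] ℝ) (fun q ↦ V q →L[ℝ] ℝ)) 1 :=
  LieAlgebroid.oneForm fun p ↦ sComponent 𝔸 p - liouville 𝔸 p

end contact
end

/-!
Let `f : P → P'` be a smooth map over `Q`. A section of the prolongation over `P` is pushed forward
to a section along `f` of the prolongation over `P'`, and in a local frame of the latter the bracket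
of two sections is the difference of two derivatives of coordinates, plus a term that depends only
on the values of the sections at the given point. In the exterior derivative of a pulled-back form,
the derivatives of the coordinates cancel against the Leibniz terms which arise from differentiating
the form on the sections. What is left depends on the sections only through the values of their
images over `P'`, and it is the same expression for `f` and for the identity of `P'`. Hence the
prolongation of `f` commutes with the exterior derivatives.

The contact sections correspond to each other because the Legendre transformation preserves `s` and
is defined by the derivative of `L` along the fibres.
-/

section Calculus

variable {E : Type*} [NormedAddCommGroup E] [NormedSpace ℝ E]
  {H : Type*} [TopologicalSpace H] {I : ModelWithCorners ℝ E H}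
  {M : Type*} [TopologicalSpace M] [ChartedSpace H M]
  {G : Type*} [NormedAddCommGroup G] [NormedSpace ℝ G]

theorem mvfderiv_congr {g h : M → G} {x : M} (hgh : g =ᶠ[𝓝 x] h) (v : TangentSpace I x) :
    mvfderiv I g x v = mvfderiv I h x v :=
  congrArg (fun l : E →L[ℝ] G ↦ l v) hgh.mfderiv_eq

theorem mvfderiv_comp_mfderiv {E' : Type*} [NormedAddCommGroup E'] [NormedSpace ℝ E']
    {H' : Type*} [TopologicalSpace H'] {I' : ModelWithCorners ℝ E' H'}
    {M' : Type*} [TopologicalSpace M'] [ChartedSpace H' M'] {f : M → M'} {g : M' → G} {x : M}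
    (hg : MDifferentiableAt I' 𝓘(ℝ, G) g (f x)) (hf : MDifferentiableAt I I' f x)
    (v : TangentSpace I x) :
    mvfderiv I (fun y ↦ g (f y)) x v = mvfderiv I' g (f x) (mfderiv I I' f x v) :=
  mfderiv_comp_apply x hg hf v

theorem mvfderiv_fun_sum {κ : Type*} {t : Finset κ} {g : κ → M → G} {x : M}
    (hg : ∀ r ∈ t, MDifferentiableAt I 𝓘(ℝ, G) (g r) x) (v : TangentSpace I x) :
    mvfderiv I (fun y ↦ ∑ r ∈ t, g r y) x v = ∑ r ∈ t, mvfderiv I (g r) x v := by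
  have h : HasMFDerivAt I 𝓘(ℝ, G) (fun y ↦ ∑ r ∈ t, g r y) x
      (∑ r ∈ t, (mfderiv I 𝓘(ℝ, G) (g r) x : E →L[ℝ] G)) :=
    ⟨tendsto_finsetSum _ fun r hr ↦ (hg r hr).continuousAt,
      HasFDerivWithinAt.fun_sum fun r hr ↦ (hg r hr).hasMFDerivAt.2⟩
  exact (congrArg (fun l : E →L[ℝ] G ↦ l v) h.mfderiv).trans
    (sum_apply (F := E →L[ℝ] G) _ _ _)

theorem mvfderiv_smul_apply {φ : M → ℝ} {g : M → G} {x : M}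
    (hφ : MDifferentiableAt I 𝓘(ℝ, ℝ) φ x) (hg : MDifferentiableAt I 𝓘(ℝ, G) g x)
    (v : TangentSpace I x) :
    mvfderiv I (fun y ↦ φ y • g y) x v = φ x • mvfderiv I g x v + mvfderiv I φ x v • g x :=
  congrArg (fun l : E →L[ℝ] G ↦ l v) (mvfderiv_smul hφ hg)

theorem mvfderiv_prodMk {G' : Type*} [NormedAddCommGroup G'] [NormedSpace ℝ G'] {g : M → G}
    {g' : M → G'} {x : M} (hg : MDifferentiableAt I 𝓘(ℝ, G) g x)
    (hg' : MDifferentiableAt I 𝓘(ℝ, G') g' x) (v : TangentSpace I x) :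
    mvfderiv I (fun y ↦ (g y, g' y)) x v = (mvfderiv I g x v, mvfderiv I g' x v) := by
  have h : HasMFDerivAt I 𝓘(ℝ, G × G') (fun y ↦ (g y, g' y)) x
      (ContinuousLinearMap.prod (mfderiv I 𝓘(ℝ, G) g x : E →L[ℝ] G) (mfderiv I 𝓘(ℝ, G') g' x)) :=
    ⟨hg.continuousAt.prodMk hg'.continuousAt, hg.hasMFDerivAt.2.prodMk hg'.hasMFDerivAt.2⟩
  exact congrArg (fun l : E →L[ℝ] G × G' ↦ l v) h.mfderiv

section Multilinear

variable {ι K : Type*} [Fintype ι] [NormedAddCommGroup K] [NormedSpace ℝ K]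

theorem hasMFDerivAt_continuousMultilinearMap_comp [DecidableEq ι]
    (β : ContinuousMultilinearMap ℝ (fun _ : ι ↦ K) G) {c : ι → M → K} {x : M}
    (hc : ∀ i, MDifferentiableAt I 𝓘(ℝ, K) (c i) x) :
    HasMFDerivAt I 𝓘(ℝ, G) (fun y ↦ β fun i ↦ c i y) x
      (∑ i, β.toContinuousLinearMap (fun j ↦ c j x) i ∘L mfderiv I 𝓘(ℝ, K) (c i) x) := by
  refine ⟨β.cont.continuousAt.comp (continuousAt_pi.2 fun i ↦ (hc i).continuousAt), ?_⟩
  have h := HasFDerivWithinAt.multilinear_comp β fun i ↦ (hc i).hasMFDerivAt.2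
  simp only [writtenInExtChartAt, Function.comp_apply, extChartAt_to_inv] at h
  exact h

theorem exists_multilinearMap_apply_eq_sum [FiniteDimensional ℝ K] [DecidableEq ι] :
    ∃ (n : ℕ) (b : Fin n → K) (β : (ι → Fin n) → ContinuousMultilinearMap ℝ (fun _ : ι ↦ K) ℝ),
      ∀ (m : MultilinearMap ℝ (fun _ : ι ↦ K) G) (z : ι → K),
        m z = ∑ r, β r z • m fun i ↦ b (r i) := by
  let b := Module.finBasis ℝ K
  refine ⟨_, b, fun r ↦ (ContinuousMultilinearMap.mkPiAlgebra ℝ ι ℝ).compContinuousLinearMap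
    fun i ↦ LinearMap.toContinuousLinearMap (b.coord (r i)), fun m z ↦ ?_⟩
  conv_lhs => rw [show z = fun i ↦ ∑ j, b.repr (z i) j • b j from
    funext fun i ↦ (b.sum_repr (z i)).symm]
  rw [m.map_sum]
  exact Finset.sum_congr rfl fun r _ ↦ m.map_smul_univ _ _

theorem mvfderiv_multilinearMap_apply [FiniteDimensional ℝ K] [DecidableEq ι]
    {m : M → MultilinearMap ℝ (fun _ : ι ↦ K) G} {c : ι → M → K} {x : M}
    (hm : ∀ z, MDifferentiableAt I 𝓘(ℝ, G) (fun y ↦ m y z) x)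
    (hc : ∀ i, MDifferentiableAt I 𝓘(ℝ, K) (c i) x) (v : TangentSpace I x) :
    mvfderiv I (fun y ↦ m y fun i ↦ c i y) x v =
      mvfderiv I (fun y ↦ m y fun i ↦ c i x) x v +
        ∑ i, m x (Function.update (fun i ↦ c i x) i (mvfderiv I (c i) x v)) := by
  obtain ⟨n, b, β, apply_eq⟩ := exists_multilinearMap_apply_eq_sum (ι := ι) (K := K) (G := G)
  have hβ (r) := hasMFDerivAt_continuousMultilinearMap_comp (β r) hc
  have hβ_deriv (r) : mvfderiv I (fun y ↦ β r fun i ↦ c i y) x v =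
      ∑ i, β r (Function.update (fun i ↦ c i x) i (mvfderiv I (c i) x v)) := by
    exact (congrArg (fun l : E →L[ℝ] ℝ ↦ l v) (hβ r).mfderiv).trans
      (sum_apply (F := E →L[ℝ] ℝ) _ _ _)
  have hβm (r) : MDifferentiableAt I 𝓘(ℝ, G)
      (fun y ↦ β r (fun i ↦ c i y) • m y fun i ↦ b (r i)) x :=
    (hβ r).mdifferentiableAt.smul (hm _)
  have hm' (r) : MDifferentiableAt I 𝓘(ℝ, G)
      (fun y ↦ β r (fun i ↦ c i x) • m y fun i ↦ b (r i)) x :=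
    mdifferentiableAt_const.smul (hm _)
  rw [funext fun y ↦ apply_eq (m y) fun i ↦ c i y, funext fun y ↦ apply_eq (m y) fun i ↦ c i x,
    Finset.sum_congr rfl fun i _ ↦ apply_eq (m x) _,
    mvfderiv_fun_sum fun r _ ↦ hβm r, mvfderiv_fun_sum fun r _ ↦ hm' r,
    Finset.sum_comm, ← Finset.sum_add_distrib]
  refine Finset.sum_congr rfl fun r _ ↦ ?_
  rw [mvfderiv_smul_apply (hβ r).mdifferentiableAt (hm _),
    mvfderiv_smul_apply mdifferentiableAt_const (hm _), hβ_deriv, Finset.sum_smul, mvfderiv_const]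
  simp

end Multilinear

open VectorField

theorem mvfderiv_comp_extChartAt [IsManifold I 1 M] {x : M} {h : E → G}
    (hh : DifferentiableAt ℝ h (extChartAt I x x)) (v : TangentSpace I x) :
    mvfderiv I (fun y ↦ h (extChartAt I x y)) x v = fderiv ℝ h (extChartAt I x x) v := by
  rw [mvfderiv_comp_mfderiv hh.mdifferentiableAt
    ((contMDiffAt_extChartAt (n := 1)).mdifferentiableAt one_ne_zero), mfderiv_extChartAt_self]
  exact congrArg (fun l : E →L[ℝ] G ↦ l v) mfderiv_eq_fderiv

variable [I.Boundaryless]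

theorem mlieBracket_eq_lieBracket_mpullbackWithin [IsManifold I 1 M] (x : M)
    (X Y : ∀ y : M, TangentSpace I y) :
    mlieBracket I X Y x =
      lieBracket ℝ (mpullbackWithin 𝓘(ℝ, E) I (extChartAt I x).symm X univ)
        (mpullbackWithin 𝓘(ℝ, E) I (extChartAt I x).symm Y univ) (extChartAt I x x) := by
  rw [← mlieBracketWithin_univ, mlieBracketWithin_apply, preimage_univ, univ_inter,
    I.range_eq_univ]
  refine (congrArg (fun l : E →L[ℝ] E ↦ l _) ((congrArg (fun l : E →L[ℝ] E ↦ l.inverse)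
    mfderiv_extChartAt_self).trans ContinuousLinearMap.inverse_id)).trans ?_
  exact congrFun (lieBracketWithin_univ (𝕜 := ℝ) (E := E)) _

theorem mfderiv_extChartAt_symm_mpullbackWithin [IsManifold I 1 M] {x : M}
    (X : ∀ y : M, TangentSpace I y) {z : E} (hz : z ∈ (extChartAt I x).target) :
    mfderiv 𝓘(ℝ, E) I (extChartAt I x).symm z
      (mpullbackWithin 𝓘(ℝ, E) I (extChartAt I x).symm X univ z) = X ((extChartAt I x).symm z) := by
  have hinv := isInvertible_mfderivWithin_extChartAt_symm (I := I) hz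
  rw [I.range_eq_univ, mfderivWithin_univ] at hinv
  rw [mpullbackWithin_apply, mfderivWithin_univ]
  exact hinv.self_apply_inverse _

theorem mpullbackWithin_extChartAt_symm_self [IsManifold I 1 M] (x : M)
    (X : ∀ y : M, TangentSpace I y) :
    mpullbackWithin 𝓘(ℝ, E) I (extChartAt I x).symm X univ (extChartAt I x x) = X x := by
  have h := mfderivWithin_extChartAt_symm_inverse_apply (I := I) (X x)
  rw [I.range_eq_univ] at h
  exact (congrArg (fun y ↦ (mfderivWithin 𝓘(ℝ, E) I (extChartAt I x).symm univ
    (extChartAt I x x) : E →L[ℝ] E).inverse (X y : E)) (extChartAt_to_inv x)).trans h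

theorem mvfderiv_vectorField_eventuallyEq [IsManifold I 2 M] {g : M → G} {x : M}
    (hg : ContMDiffAt I 𝓘(ℝ, G) 2 g x) (X : ∀ y : M, TangentSpace I y) :
    (fun y ↦ mvfderiv I g y (X y)) =ᶠ[𝓝 x]
      fun y ↦ fderiv ℝ (g ∘ (extChartAt I x).symm) (extChartAt I x y)
        (mpullbackWithin 𝓘(ℝ, E) I (extChartAt I x).symm X univ (extChartAt I x y)) := by
  filter_upwards [(contMDiffAt_iff_contMDiffAt_nhds (by simp)).1 hg,
    extChartAt_source_mem_nhds (I := I) x] with y hgy hy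
  have hz := (extChartAt I x).map_source hy
  have hsymm : MDifferentiableAt 𝓘(ℝ, E) I (extChartAt I x).symm (extChartAt I x y) :=
    (mdifferentiableOn_extChartAt_symm _ hz).mdifferentiableAt
      (extChartAt_target_mem_nhds' hz)
  have hinv := (extChartAt I x).left_inv hy
  rw [← hinv] at hgy
  have h := mvfderiv_comp_mfderiv (hgy.mdifferentiableAt two_ne_zero) hsymm
    (mpullbackWithin 𝓘(ℝ, E) I (extChartAt I x).symm X univ (extChartAt I x y))
  rw [mfderiv_extChartAt_symm_mpullbackWithin X hz, hinv] at h
  exact h.symm.trans (congrArg (fun l : E →L[ℝ] G ↦ l _) mfderiv_eq_fderiv)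

theorem differentiableAt_mpullbackWithin_extChartAt_symm [CompleteSpace E] [IsManifold I 2 M]
    {x : M} {X : ∀ y : M, TangentSpace I y}
    (hX : MDifferentiableAt I I.tangent (fun y ↦ (⟨y, X y⟩ : TangentBundle I M)) x) :
    DifferentiableAt ℝ (mpullbackWithin 𝓘(ℝ, E) I (extChartAt I x).symm X univ)
      (extChartAt I x x) := by
  have h := (mdifferentiableWithinAt_univ.2 hX).differentiableWithinAt_mpullbackWithin_vectorField
  rw [preimage_univ, univ_inter, I.range_eq_univ] at h
  exact differentiableWithinAt_univ.1 h

theorem mvfderiv_mlieBracket [CompleteSpace E] [IsManifold I 2 M] {g : M → G}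
    {x : M} {X Y : ∀ y : M, TangentSpace I y} (hg : ContMDiffAt I 𝓘(ℝ, G) 2 g x)
    (hX : MDifferentiableAt I I.tangent (fun y ↦ (⟨y, X y⟩ : TangentBundle I M)) x)
    (hY : MDifferentiableAt I I.tangent (fun y ↦ (⟨y, Y y⟩ : TangentBundle I M)) x) :
    mvfderiv I g x (mlieBracket I X Y x) =
      mvfderiv I (fun y ↦ mvfderiv I g y (Y y)) x (X x) -
        mvfderiv I (fun y ↦ mvfderiv I g y (X y)) x (Y x) := by
  let χ := extChartAt I x
  have hĝ : ContDiffAt ℝ 2 (g ∘ χ.symm) (χ x) := by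
    have h := (contMDiffAt_iff_source (I := I)).1 hg
    rw [I.range_eq_univ] at h
    exact (h.contMDiffAt Filter.univ_mem).contDiffAt
  have hderiv {Z : ∀ y : M, TangentSpace I y}
      (hZ : MDifferentiableAt I I.tangent (fun y ↦ (⟨y, Z y⟩ : TangentBundle I M)) x)
      (v : TangentSpace I x) : mvfderiv I (fun y ↦ mvfderiv I g y (Z y)) x v =
        fderiv ℝ (fun z ↦ fderiv ℝ (g ∘ χ.symm) z (mpullbackWithin 𝓘(ℝ, E) I χ.symm Z univ z))
          (χ x) v :=
    (mvfderiv_congr (mvfderiv_vectorField_eventuallyEq hg Z) v).trans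
      (mvfderiv_comp_extChartAt (((hĝ.fderiv_right (m := 1) le_rfl).differentiableAt
        one_ne_zero).clm_apply (differentiableAt_mpullbackWithin_extChartAt_symm hZ)) v)
  have hvalue (v : TangentSpace I x) :
      mvfderiv I g x v = fderiv ℝ (g ∘ χ.symm) (χ x) v :=
    (mvfderiv_congr (h := fun y ↦ (g ∘ χ.symm) (χ y)) (by
      filter_upwards [extChartAt_source_mem_nhds (I := I) x] with y hy
      exact congrArg g (χ.left_inv hy).symm) v).trans
      (mvfderiv_comp_extChartAt (hĝ.differentiableAt two_ne_zero) v)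
  have hbracket := VectorField.fderiv_apply_lieBracket hĝ (by simp)
    (differentiableAt_mpullbackWithin_extChartAt_symm hY)
    (differentiableAt_mpullbackWithin_extChartAt_symm hX)
  rw [mpullbackWithin_extChartAt_symm_self, mpullbackWithin_extChartAt_symm_self] at hbracket
  rw [hvalue, mlieBracket_eq_lieBracket_mpullbackWithin, hderiv hY, hderiv hX]
  exact hbracket

end Calculus

section Coordinates

theorem eventually_mem_baseSet {X B F : Type*} [TopologicalSpace X] [TopologicalSpace B]
    [TopologicalSpace F] {V : B → Type*} [∀ b, TopologicalSpace (V b)]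
    [TopologicalSpace (TotalSpace F V)] [FiberBundle F V] {g : X → B} {x₀ : X}
    (hg : ContinuousAt g x₀) : ∀ᶠ x in 𝓝 x₀, g x ∈ (trivializationAt F V (g x₀)).baseSet :=
  hg.preimage_mem_nhds ((trivializationAt F V (g x₀)).open_baseSet.mem_nhds
    (FiberBundle.mem_baseSet_trivializationAt' (g x₀)))

variable {E : Type*} [NormedAddCommGroup E] [NormedSpace ℝ E]
  {H : Type*} [TopologicalSpace H] {I : ModelWithCorners ℝ E H}
  {M : Type*} [TopologicalSpace M]
  {F : Type*} [NormedAddCommGroup F] [NormedSpace ℝ F]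
  {EN : Type*} [NormedAddCommGroup EN] [NormedSpace ℝ EN]
  {HN : Type*} [TopologicalSpace HN] {JN : ModelWithCorners ℝ EN HN}
  {N : Type*} [TopologicalSpace N] [ChartedSpace HN N]
  {V : M → Type*} [TopologicalSpace (TotalSpace F V)] [∀ b, AddCommGroup (V b)]
  [∀ b, Module ℝ (V b)] [∀ b, TopologicalSpace (V b)] [FiberBundle F V] [VectorBundle ℝ F V]

variable (F) in
/-- The linear coordinates on the fibre `V b` given by the preferred trivialization at `b₀`; for
the tangent bundle, the components of a tangent vector in the preferred chart at `b₀`. They are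
`0` where that trivialization is not defined. -/
noncomputable def fibreCoord (b₀ b : M) : V b →L[ℝ] F :=
  (trivializationAt F V b₀).continuousLinearMapAt ℝ b

theorem fibreCoord_apply {b₀ b : M} (hb : b ∈ (trivializationAt F V b₀).baseSet) (a : V b) :
    fibreCoord F b₀ b a = (trivializationAt F V b₀ ⟨b, a⟩).2 := by
  rw [fibreCoord, Trivialization.continuousLinearMapAt_apply, Trivialization.linearMapAt_apply,
    if_pos hb]

theorem fibreCoord_symmL {b₀ b : M} (hb : b ∈ (trivializationAt F V b₀).baseSet) (z : F) :
    fibreCoord F b₀ b ((trivializationAt F V b₀).symmL ℝ b z) = z :=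
  Trivialization.continuousLinearMapAt_symmL _ hb z

theorem symmL_fibreCoord {b₀ b : M} (hb : b ∈ (trivializationAt F V b₀).baseSet) (a : V b) :
    (trivializationAt F V b₀).symmL ℝ b (fibreCoord F b₀ b a) = a :=
  Trivialization.symmL_continuousLinearMapAt _ hb a

theorem fibreCoord_injective {b₀ b : M} (hb : b ∈ (trivializationAt F V b₀).baseSet) :
    Function.Injective (fibreCoord F b₀ b : V b → F) :=
  Function.LeftInverse.injective (symmL_fibreCoord hb)

variable [ChartedSpace H M]

theorem contMDiffAt_totalSpace_iff_fibreCoord [ContMDiffVectorBundle ∞ F V I]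
    {g : N → M} {a : ∀ x, V (g x)} {x₀ : N} {b₀ : M} (hg : ContMDiffAt JN I ∞ g x₀)
    (hb : g x₀ ∈ (trivializationAt F V b₀).baseSet) :
    ContMDiffAt JN (I.prod 𝓘(ℝ, F)) ∞ (fun x ↦ (⟨g x, a x⟩ : TotalSpace F V)) x₀ ↔
      ContMDiffAt JN 𝓘(ℝ, F) ∞ (fun x ↦ fibreCoord F b₀ (g x) (a x)) x₀ := by
  rw [(trivializationAt F V b₀).contMDiffAt_iff (IB := I)
    (by simpa [Trivialization.mem_source] using hb), and_iff_right (by exact hg)]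
  refine Filter.EventuallyEq.contMDiffAt_iff ?_
  filter_upwards [hg.continuousAt.preimage_mem_nhds
    ((trivializationAt F V b₀).open_baseSet.mem_nhds hb)] with x hx
  exact (fibreCoord_apply hx (a x)).symm

theorem contMDiffAt_totalSpace_symmL [ContMDiffVectorBundle ∞ F V I]
    {g : N → M} {z : N → F} {x₀ : N} {b₀ : M} (hg : ContMDiffAt JN I ∞ g x₀)
    (hz : ContMDiffAt JN 𝓘(ℝ, F) ∞ z x₀) (hb : g x₀ ∈ (trivializationAt F V b₀).baseSet) :
    ContMDiffAt JN (I.prod 𝓘(ℝ, F)) ∞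
      (fun x ↦ (⟨g x, (trivializationAt F V b₀).symmL ℝ (g x) (z x)⟩ : TotalSpace F V)) x₀ := by
  refine (contMDiffAt_totalSpace_iff_fibreCoord hg hb).2 (hz.congr_of_eventuallyEq ?_)
  filter_upwards [hg.continuousAt.preimage_mem_nhds
    ((trivializationAt F V b₀).open_baseSet.mem_nhds hb)] with x hx
  exact fibreCoord_symmL hx (z x)

end Coordinates

section TangentCoordinates

variable {E : Type*} [NormedAddCommGroup E] [NormedSpace ℝ E]
  {H : Type*} [TopologicalSpace H] {I : ModelWithCorners ℝ E H}
  {M : Type*} [TopologicalSpace M] [ChartedSpace H M]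
  {EN : Type*} [NormedAddCommGroup EN] [NormedSpace ℝ EN]
  {HN : Type*} [TopologicalSpace HN] {JN : ModelWithCorners ℝ EN HN}
  {N : Type*} [TopologicalSpace N] [ChartedSpace HN N]

theorem mvfderiv_extChartAt_comp [IsManifold I 1 M] {x₀ : M} {f : N → M} {x : N}
    (hf : MDifferentiableAt JN I f x) (hx : f x ∈ (chartAt H x₀).source) (v : TangentSpace JN x) :
    mvfderiv JN (fun y ↦ extChartAt I x₀ (f y)) x v =
      fibreCoord E x₀ (f x) (mfderiv JN I f x v) :=
  (mvfderiv_comp_mfderiv (mdifferentiableAt_extChartAt hx) hf v).trans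
    (congrArg (fun l : E →L[ℝ] E ↦ l (mfderiv JN I f x v))
      (TangentBundle.continuousLinearMapAt_trivializationAt hx)).symm

theorem fibreCoord_mfderiv_mlieBracket [JN.Boundaryless] [CompleteSpace EN] [IsManifold JN 2 N]
    [IsManifold I 2 M] {f : N → M} {x : N} (hf : ContMDiffAt JN I 2 f x)
    {X Y : ∀ y : N, TangentSpace JN y}
    (hX : MDifferentiableAt JN JN.tangent (fun y ↦ (⟨y, X y⟩ : TangentBundle JN N)) x)
    (hY : MDifferentiableAt JN JN.tangent (fun y ↦ (⟨y, Y y⟩ : TangentBundle JN N)) x) :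
    fibreCoord E (f x) (f x) (mfderiv JN I f x (VectorField.mlieBracket JN X Y x)) =
      mvfderiv JN (fun y ↦ fibreCoord E (f x) (f y) (mfderiv JN I f y (Y y))) x (X x) -
        mvfderiv JN (fun y ↦ fibreCoord E (f x) (f y) (mfderiv JN I f y (X y))) x (Y x) := by
  have hderiv (Z : ∀ y : N, TangentSpace JN y) :
      (fun y ↦ mvfderiv JN (fun z ↦ extChartAt I (f x) (f z)) y (Z y)) =ᶠ[𝓝 x]
        fun y ↦ fibreCoord E (f x) (f y) (mfderiv JN I f y (Z y)) := by
    filter_upwards [(contMDiffAt_iff_contMDiffAt_nhds (by simp)).1 hf,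
      hf.continuousAt.preimage_mem_nhds (chart_source_mem_nhds H (f x))] with y hfy hy
    exact mvfderiv_extChartAt_comp (hfy.mdifferentiableAt two_ne_zero) hy (Z y)
  rw [← mvfderiv_congr (hderiv X), ← mvfderiv_congr (hderiv Y)]
  exact (hderiv (VectorField.mlieBracket JN X Y)).self_of_nhds.symm.trans
    (mvfderiv_mlieBracket (contMDiffAt_extChartAt.comp x hf) hX hY)

end TangentCoordinates

section SmoothFunctions

theorem contMDiffOn_dirDeriv_vectorField {EP : Type*} [NormedAddCommGroup EP] [NormedSpace ℝ EP]
    {HP : Type*} [TopologicalSpace HP] {J : ModelWithCorners ℝ EP HP}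
    {P : Type*} [TopologicalSpace P] [ChartedSpace HP P] [IsManifold J ∞ P] {f : P → ℝ}
    (hf : ContMDiff J 𝓘(ℝ, ℝ) ∞ f) {X : ∀ p : P, TangentSpace J p} {U : Set P}
    (hX : ContMDiffOn J J.tangent ∞ (fun p ↦ (⟨p, X p⟩ : TangentBundle J P)) U) :
    ContMDiffOn J 𝓘(ℝ, ℝ) ∞ (fun p ↦ dirDeriv J f p (X p)) U :=
  (contMDiff_snd_tangentBundle_modelSpace ℝ 𝓘(ℝ, ℝ)).comp_contMDiffOn
    ((hf.contMDiff_tangentMap (m := ∞) (by simp)).comp_contMDiffOn hX)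

theorem exists_contMDiffMap_dirDeriv_eq {E : Type*} [NormedAddCommGroup E] [NormedSpace ℝ E]
    [FiniteDimensional ℝ E] {H : Type*} [TopologicalSpace H] {I : ModelWithCorners ℝ E H}
    {M : Type*} [TopologicalSpace M] [T2Space M] [ChartedSpace H M] [IsManifold I ∞ M] (x : M)
    (l : E →L[ℝ] ℝ) :
    ∃ f : C^∞⟮I, M; ℝ⟯, ∀ v : TangentSpace I x, dirDeriv I f x v = l v := by
  obtain ⟨χ⟩ : Nonempty (SmoothBumpFunction I x) := inferInstance
  have hl : ContMDiffOn I 𝓘(ℝ, ℝ) ∞ (l ∘ extChartAt I x) (chartAt H x).source :=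
    l.contDiff.contMDiff.comp_contMDiffOn contMDiffOn_extChartAt
  refine ⟨⟨_, χ.contMDiff_smul hl⟩, fun v ↦ ?_⟩
  have hχ : (fun y ↦ χ y • (l ∘ extChartAt I x) y) =ᶠ[𝓝 x] fun y ↦ l (extChartAt I x y) := by
    filter_upwards [χ.eventuallyEq_one] with y hy
    rw [hy, Pi.one_apply, one_smul, Function.comp_apply]
  exact (mvfderiv_congr hχ v).trans ((mvfderiv_comp_extChartAt l.differentiableAt v).trans
    (congrArg (fun l' : E →L[ℝ] ℝ ↦ l' v) l.fderiv))

end SmoothFunctions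

section RightInverse

variable {EP : Type*} [NormedAddCommGroup EP] [NormedSpace ℝ EP]
  {HP : Type*} [TopologicalSpace HP] {J : ModelWithCorners ℝ EP HP}
  {P : Type*} [TopologicalSpace P] [ChartedSpace HP P]
  {E₁ E₂ : Type*} [NormedAddCommGroup E₁] [NormedSpace ℝ E₁] [NormedAddCommGroup E₂]
  [NormedSpace ℝ E₂]

theorem contMDiffOn_clm_of_forall_apply [FiniteDimensional ℝ E₁] {T : P → E₁ →L[ℝ] E₂} {U : Set P}
    (hT : ∀ v, ContMDiffOn J 𝓘(ℝ, E₂) ∞ (fun x ↦ T x v) U) :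
    ContMDiffOn J 𝓘(ℝ, E₁ →L[ℝ] E₂) ∞ T U := by
  let b := Module.finBasis ℝ E₁
  have hsum : T = fun x ↦ ∑ i, ContinuousLinearMap.smulRightL ℝ E₁ E₂
      (LinearMap.toContinuousLinearMap (b.coord i)) (T x (b i)) := by
    funext x
    refine ContinuousLinearMap.coe_injective (b.ext fun j ↦ ?_)
    simp [Finsupp.single_apply]
  rw [hsum]
  exact contMDiffOn_finsetSum fun i _ ↦ (ContinuousLinearMap.contMDiff _).comp_contMDiffOn (hT _)

theorem exists_contMDiffOn_rightInverse [FiniteDimensional ℝ E₂] {T : P → E₁ →L[ℝ] E₂} {W : Set P}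
    {p : P} (hW : IsOpen W) (hp : p ∈ W) (hT : ∀ v, ContMDiffOn J 𝓘(ℝ, E₂) ∞ (fun x ↦ T x v) W)
    (hsurj : Function.Surjective (T p)) :
    ∃ (U : Set P) (R : P → E₂ →L[ℝ] E₁), IsOpen U ∧ p ∈ U ∧ U ⊆ W ∧
      (∀ x ∈ U, ∀ v, T x (R x v) = v) ∧ ContMDiffOn J 𝓘(ℝ, E₂ →L[ℝ] E₁) ∞ R U := by
  obtain ⟨r, hr⟩ :=
    (T p).toLinearMap.exists_rightInverse_of_surjective (LinearMap.range_eq_top.2 hsurj)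
  let R₀ : E₂ →L[ℝ] E₁ := LinearMap.toContinuousLinearMap r
  have hTR : ContMDiffOn J 𝓘(ℝ, E₂ →L[ℝ] E₂) ∞ (fun x ↦ T x ∘L R₀) W :=
    contMDiffOn_clm_of_forall_apply fun v ↦ hT (R₀ v)
  have hTRp : T p ∘L R₀ = 1 := ContinuousLinearMap.coe_injective hr
  have : CompleteSpace E₂ := FiniteDimensional.complete ℝ E₂
  refine ⟨W ∩ (fun x ↦ T x ∘L R₀) ⁻¹' {u | IsUnit u}, fun x ↦ R₀ ∘L Ring.inverse (T x ∘L R₀),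
    hTR.continuousOn.isOpen_inter_preimage hW Units.isOpen, ⟨hp, ?_⟩, inter_subset_left, ?_, ?_⟩
  · exact (congrArg IsUnit hTRp).mpr isUnit_one
  · exact fun x hx v ↦ congrArg (fun u : E₂ →L[ℝ] E₂ ↦ u v) (Ring.mul_inverse_cancel _ hx.2)
  · intro x hx
    obtain ⟨u, hu⟩ := hx.2
    have hinv : ContMDiffAt 𝓘(ℝ, E₂ →L[ℝ] E₂) 𝓘(ℝ, E₂ →L[ℝ] E₂) ∞ Ring.inverse (T x ∘L R₀) :=
      (congrArg (ContMDiffAt _ _ ∞ Ring.inverse) hu).mp (contDiffAt_ringInverse ℝ u).contMDiffAt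
    exact contMDiffWithinAt_const.clm_comp (hinv.comp_contMDiffWithinAt x
      ((hTR x hx.1).mono inter_subset_left))

end RightInverse

namespace LieAlgebroid

section CoordDomain

variable (EQ : Type*) [TopologicalSpace EQ] {Q : Type*} [TopologicalSpace Q] [ChartedSpace EQ Q]
  (F : Type*) [TopologicalSpace F] (V : Q → Type*) [TopologicalSpace (TotalSpace F V)]
  [∀ q, TopologicalSpace (V q)] [FiberBundle F V]
  (HP : Type*) [TopologicalSpace HP] {P : Type*} [TopologicalSpace P] [ChartedSpace HP P]
  (pr : P → Q)

/-- The points of `P` at which the coordinates of `TP` at `p₀` and those of `V` and `TQ` at `pr p₀`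
are all defined. -/
def coordDomain (p₀ : P) : Set P :=
  (chartAt HP p₀).source ∩
    pr ⁻¹' ((trivializationAt F V (pr p₀)).baseSet ∩ (chartAt EQ (pr p₀)).source)

variable {pr} in
theorem isOpen_coordDomain (hpr : Continuous pr) (p₀ : P) : IsOpen (coordDomain EQ F V HP pr p₀) :=
  (chartAt HP p₀).open_source.inter
    (((trivializationAt F V (pr p₀)).open_baseSet.inter (chartAt EQ (pr p₀)).open_source).preimage
      hpr)

theorem mem_coordDomain_self (p₀ : P) : p₀ ∈ coordDomain EQ F V HP pr p₀ :=
  ⟨mem_chart_source HP p₀, FiberBundle.mem_baseSet_trivializationAt' (pr p₀),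
    mem_chart_source EQ (pr p₀)⟩

end CoordDomain

section Projection

variable {EQ : Type*} [NormedAddCommGroup EQ] [NormedSpace ℝ EQ]
  {Q : Type*} [TopologicalSpace Q] [ChartedSpace EQ Q] [IsManifold 𝓘(ℝ, EQ) ∞ Q]
  {EP : Type*} [NormedAddCommGroup EP] [NormedSpace ℝ EP]
  {HP : Type*} [TopologicalSpace HP] {J : ModelWithCorners ℝ EP HP}
  {P : Type*} [TopologicalSpace P] [ChartedSpace HP P] [IsManifold J ∞ P] {pr : P → Q}

variable (EQ J pr) in
/-- The derivative `T_p P → T_{pr p} Q` of `pr` in the coordinates of `TP` at `p₀` and of `TQ`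
at `pr p₀`. -/
noncomputable def projCoord (p₀ p : P) : EP →L[ℝ] EQ :=
  (fibreCoord EQ (pr p₀) (pr p) : TangentSpace 𝓘(ℝ, EQ) (pr p) →L[ℝ] EQ) ∘L
    mfderiv J 𝓘(ℝ, EQ) pr p ∘L (trivializationAt EP (TangentSpace J) p₀).symmL ℝ p

theorem projCoord_fibreCoord {p₀ p : P} (hp : p ∈ (chartAt HP p₀).source) (v : TangentSpace J p) :
    projCoord EQ J pr p₀ p (fibreCoord EP p₀ p v) =
      fibreCoord EQ (pr p₀) (pr p) (mfderiv J 𝓘(ℝ, EQ) pr p v) :=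
  congrArg (fun w ↦ (fibreCoord EQ (pr p₀) (pr p) : TangentSpace 𝓘(ℝ, EQ) (pr p) →L[ℝ] EQ)
    (mfderiv J 𝓘(ℝ, EQ) pr p w)) (symmL_fibreCoord hp v)

theorem contMDiffAt_projCoord_apply {p₀ p : P} (hpr : ContMDiff J 𝓘(ℝ, EQ) ∞ pr)
    (hp : p ∈ (chartAt HP p₀).source) (hq : pr p ∈ (chartAt EQ (pr p₀)).source) (v : EP) :
    ContMDiffAt J 𝓘(ℝ, EQ) ∞ (fun p ↦ projCoord EQ J pr p₀ p v) p := by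
  have hv : ContMDiffAt J J.tangent ∞ (fun p ↦
      (⟨p, (trivializationAt EP (TangentSpace J) p₀).symmL ℝ p v⟩ : TangentBundle J P)) p :=
    contMDiffAt_totalSpace_symmL contMDiffAt_id contMDiffAt_const hp
  exact (contMDiffAt_totalSpace_iff_fibreCoord hpr.contMDiffAt hq).1
    ((hpr.contMDiff_tangentMap (m := ∞) (by simp)).contMDiffAt.comp p hv)

theorem projCoord_self_surjective {p₀ : P}
    (hsurj : Function.Surjective (mfderiv J 𝓘(ℝ, EQ) pr p₀)) :
    Function.Surjective (projCoord EQ J pr p₀ p₀) := by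
  intro z
  obtain ⟨v, hv⟩ := hsurj ((trivializationAt EQ (TangentSpace 𝓘(ℝ, EQ)) (pr p₀)).symmL ℝ (pr p₀) z)
  refine ⟨fibreCoord EP p₀ p₀ v, ?_⟩
  rw [projCoord_fibreCoord (mem_chart_source HP p₀), hv]
  exact fibreCoord_symmL (mem_chart_source EQ (pr p₀)) z

end Projection

end LieAlgebroid

section PairSum

variable {R K : Type*} [CommRing R] [AddCommGroup K] [Module R K]

/-- The sum over `i < j` of `(-1)^(i + j) m(B_ij, c_0, …, omit c_i, …, omit c_j, …, c_k)`, with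
the pairs enumerated as in `LieAlgebroid.bracketTerms`. -/
def pairSum : {k : ℕ} → K [⋀^Fin k]→ₗ[R] R → (Fin (k + 1) → Fin (k + 1) → K) →
    (Fin (k + 1) → K) → R
  | 0, _, _, _ => 0
  | k + 1, m, B, c => ∑ i : Fin (k + 1), ∑ j ∈ Finset.Ici i,
      (-1 : R) ^ ((i : ℕ) + ((j : ℕ) + 1)) *
        m (Fin.cons (B i.castSucc j.succ) (j.removeNth (i.castSucc.removeNth c)))

theorem pairSum_add {k : ℕ} (m : K [⋀^Fin k]→ₗ[R] R) (B B' : Fin (k + 1) → Fin (k + 1) → K)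
    (c : Fin (k + 1) → K) :
    pairSum m (fun i j ↦ B i j + B' i j) c = pairSum m B c + pairSum m B' c := by
  cases k with
  | zero => exact (add_zero 0).symm
  | succ k =>
    simp only [pairSum, ← Finset.sum_add_distrib, ← mul_add]
    refine Finset.sum_congr rfl fun i _ ↦ Finset.sum_congr rfl fun j _ ↦ congrArg _ ?_
    exact m.toMultilinearMap.cons_add _ _ _

theorem pairSum_compLinearMap {K' : Type*} [AddCommGroup K'] [Module R K'] {k : ℕ}
    (m : K [⋀^Fin k]→ₗ[R] R) (l : K' →ₗ[R] K) (B : Fin (k + 1) → Fin (k + 1) → K')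
    (c : Fin (k + 1) → K') :
    pairSum (m.compLinearMap l) B c = pairSum m (fun i j ↦ l (B i j)) (fun i ↦ l (c i)) := by
  cases k with
  | zero => rfl
  | succ k =>
    refine Finset.sum_congr rfl fun i _ ↦ Finset.sum_congr rfl fun j _ ↦ congrArg _ ?_
    exact congrArg m (Fin.comp_cons l _ _)

theorem sum_update_removeNth_add_pairSum_eq_zero {k : ℕ} (m : K [⋀^Fin k]→ₗ[R] R)
    (d : Fin (k + 1) → Fin (k + 1) → K) (c : Fin (k + 1) → K) :
    ∑ i : Fin (k + 1), (-1 : R) ^ (i : ℕ) *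
        ∑ j, m (Function.update (i.removeNth c) j (d i (i.succAbove j))) +
      pairSum m (fun i j ↦ d i j - d j i) c = 0 := by
  cases k with
  | zero => simp [pairSum]
  | succ k =>
    simp only [pairSum, Finset.mul_sum]
    rw [Fin.sum_sum_eq_sum_triangle_add]
    simp only [← Finset.sum_add_distrib]
    refine Finset.sum_eq_zero fun i _ ↦ Finset.sum_eq_zero fun j hj ↦ ?_
    rw [Finset.mem_Ici] at hj
    have succAbove_j : i.castSucc.succAbove j = j.succ := by simp [Fin.succAbove_of_le_castSucc, hj]
    have succAbove_i : j.succ.succAbove i = i.castSucc := by simp [Fin.succAbove_of_castSucc_lt, hj]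
    have removeNth_comm : i.removeNth (j.succ.removeNth c) =
        j.removeNth (i.castSucc.removeNth c) := by
      rw [Fin.removeNth_removeNth_eq_swap, succAbove_i,
        Fin.predAbove_succ_of_le i j hj]
    have cons_sub (x y : K) (z : Fin k → K) :
        m (Fin.cons (x - y) z) = m (Fin.cons x z) - m (Fin.cons y z) := by
      simpa [Fin.update_cons_zero] using m.map_update_sub (Fin.cons x z) 0 x y
    simp only [← Fin.insertNth_removeNth, AlternatingMap.map_insertNth,
      removeNth_comm, succAbove_j, succAbove_i, cons_sub, Fin.val_castSucc, Fin.val_succ]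
    change _ * (_ • m (Fin.cons _ _)) + _ * (_ • m (Fin.cons _ _)) + _ = _
    simp only [pow_add, pow_one, zsmul_eq_mul, Int.cast_pow, Int.cast_neg, Int.cast_one]
    ring

end PairSum

section Algebroid

variable {EQ : Type*} [NormedAddCommGroup EQ] [NormedSpace ℝ EQ]
  {Q : Type*} [TopologicalSpace Q] [ChartedSpace EQ Q] [IsManifold 𝓘(ℝ, EQ) ∞ Q]
  {F : Type*} [NormedAddCommGroup F] [NormedSpace ℝ F]
  {V : Q → Type*} [TopologicalSpace (TotalSpace F V)] [∀ q, AddCommGroup (V q)]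
  [∀ q, Module ℝ (V q)] [∀ q, TopologicalSpace (V q)] [FiberBundle F V] [VectorBundle ℝ F V]

section constSection

variable [FiniteDimensional ℝ EQ] [T2Space Q] [ContMDiffVectorBundle ∞ F V 𝓘(ℝ, EQ)]

theorem constSection_eventuallyEq {q : Q} (a : V q) : ∀ᶠ q' in 𝓝 q,
    constSection EQ F a q' = (trivializationAt F V q).symmL ℝ q' (fibreCoord F q q a) := by
  filter_upwards [(exists_bump_trivializationAt EQ F V q).choose.eventuallyEq_one,
    (trivializationAt F V q).open_baseSet.mem_nhds
      (FiberBundle.mem_baseSet_trivializationAt' q)] with q' hbump hq'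
  change (exists_bump_trivializationAt EQ F V q).choose q' • FiberBundle.extend F a q' = _
  rw [hbump, Pi.one_apply, one_smul, Trivialization.symmL_apply _ hq',
    fibreCoord_apply (FiberBundle.mem_baseSet_trivializationAt' q)]
  simp [FiberBundle.extend]

theorem constSection_self {q : Q} (a : V q) : constSection EQ F a q = a :=
  (constSection_eventuallyEq a).self_of_nhds.trans
    (symmL_fibreCoord (FiberBundle.mem_baseSet_trivializationAt' q) a)

end constSection

namespace LieAlgebroid

variable (𝔸 : LieAlgebroid EQ F V)

theorem contMDiff_anchor_section (s : Cₛ^∞⟮𝓘(ℝ, EQ); F, V⟯) :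
    ContMDiff 𝓘(ℝ, EQ) 𝓘(ℝ, EQ).tangent ∞
      (fun q ↦ (⟨q, 𝔸.anchor q (s q)⟩ : TangentBundle 𝓘(ℝ, EQ) Q)) :=
  𝔸.contMDiff_anchor.comp s.contMDiff

/-- The derivative `ρ(s) f` of a smooth function `f` along the anchor of the section `s`. -/
noncomputable def anchorDeriv (s : Cₛ^∞⟮𝓘(ℝ, EQ); F, V⟯) (f : C^∞⟮𝓘(ℝ, EQ), Q; ℝ⟯) :
    C^∞⟮𝓘(ℝ, EQ), Q; ℝ⟯ :=
  ⟨fun q ↦ dirDeriv 𝓘(ℝ, EQ) f q (𝔸.anchor q (s q)),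
    contMDiffOn_univ.1 (contMDiffOn_dirDeriv_vectorField f.contMDiff
      (𝔸.contMDiff_anchor_section s).contMDiffOn)⟩

theorem bracket_smoothFunSMul (s u : Cₛ^∞⟮𝓘(ℝ, EQ); F, V⟯) (f : C^∞⟮𝓘(ℝ, EQ), Q; ℝ⟯) :
    𝔸.bracket s (smoothFunSMul f u) =
      smoothFunSMul f (𝔸.bracket s u) + smoothFunSMul (𝔸.anchorDeriv s f) u :=
  ContMDiffSection.ext fun q ↦ 𝔸.leibniz f s u q

theorem bracket_skew (s t : Cₛ^∞⟮𝓘(ℝ, EQ); F, V⟯) : 𝔸.bracket s t = -𝔸.bracket t s := by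
  have h := 𝔸.bracket_self (s + t)
  simp only [map_add, LinearMap.add_apply, 𝔸.bracket_self, zero_add, add_zero] at h
  exact eq_neg_of_add_eq_zero_right h

-- Subtract `f` times the Jacobi identity of `s, t, u` from that of `s, t, f u`.
theorem anchorDeriv_bracket_smul (s t u : Cₛ^∞⟮𝓘(ℝ, EQ); F, V⟯) (f : C^∞⟮𝓘(ℝ, EQ), Q; ℝ⟯)
    (q : Q) :
    𝔸.anchorDeriv (𝔸.bracket s t) f q • u q =
      (𝔸.anchorDeriv s (𝔸.anchorDeriv t f) q - 𝔸.anchorDeriv t (𝔸.anchorDeriv s f) q) • u q := by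
  have smul_apply (g : C^∞⟮𝓘(ℝ, EQ), Q; ℝ⟯) (σ : Cₛ^∞⟮𝓘(ℝ, EQ); F, V⟯) :
      smoothFunSMul g σ q = g q • σ q := rfl
  have jacobi_smul := congrArg (fun σ : Cₛ^∞⟮𝓘(ℝ, EQ); F, V⟯ ↦ σ q)
    (𝔸.jacobi s t (smoothFunSMul f u))
  have smul_jacobi := congrArg (fun σ : Cₛ^∞⟮𝓘(ℝ, EQ); F, V⟯ ↦ f q • σ q) (𝔸.jacobi s t u)
  simp only [𝔸.bracket_skew (smoothFunSMul f u), 𝔸.bracket_skew u, bracket_smoothFunSMul, map_add,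
    map_neg, ContMDiffSection.coe_add, ContMDiffSection.coe_neg, ContMDiffSection.coe_zero,
    Pi.add_apply, Pi.neg_apply, Pi.zero_apply, smul_apply, smul_add, smul_neg, smul_zero]
    at jacobi_smul smul_jacobi
  rw [sub_smul, ← sub_eq_zero, ← neg_eq_zero, ← sub_eq_zero_of_eq (jacobi_smul.trans
    smul_jacobi.symm)]
  abel

theorem anchor_bracket [FiniteDimensional ℝ EQ] [T2Space Q] [ContMDiffVectorBundle ∞ F V 𝓘(ℝ, EQ)]
    (s t : Cₛ^∞⟮𝓘(ℝ, EQ); F, V⟯) (q : Q) :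
    𝔸.anchor q (𝔸.bracket s t q) =
      VectorField.mlieBracket 𝓘(ℝ, EQ) (fun q ↦ 𝔸.anchor q (s q)) (fun q ↦ 𝔸.anchor q (t q)) q := by
  have fibreEquiv (q' : Q) := (trivializationAt F V q').continuousLinearEquivAt ℝ q'
    (FiberBundle.mem_baseSet_trivializationAt' q')
  rcases subsingleton_or_nontrivial F with hF | hF
  · have anchor_eq_zero (u : Cₛ^∞⟮𝓘(ℝ, EQ); F, V⟯) : (fun q ↦ 𝔸.anchor q (u q)) = 0 := by
      funext q'
      have : Subsingleton (V q') := (fibreEquiv q').injective.subsingleton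
      rw [Subsingleton.elim (u q') 0, map_zero, Pi.zero_apply]
    rw [anchor_eq_zero s, VectorField.mlieBracket_zero_left]
    exact congrFun (anchor_eq_zero _) q
  · have : Nontrivial (V q) := (fibreEquiv q).symm.injective.nontrivial
    obtain ⟨a, ha⟩ := exists_ne (0 : V q)
    refine (SeparatingDual.eq_iff_forall_dual_eq (R := ℝ) (V := EQ)).2 fun l ↦ ?_
    obtain ⟨f, hf⟩ := exists_contMDiffMap_dirDeriv_eq (I := 𝓘(ℝ, EQ)) q l
    have hdiff (u : Cₛ^∞⟮𝓘(ℝ, EQ); F, V⟯) :=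
      (𝔸.contMDiff_anchor_section u).mdifferentiableAt (x := q) (by simp)
    have h := 𝔸.anchorDeriv_bracket_smul s t (constSection EQ F a) f q
    rw [constSection_self, smul_left_inj ha] at h
    refine (hf _).symm.trans (h.trans ((mvfderiv_mlieBracket ?_ (hdiff s) (hdiff t)).symm.trans
      (hf _)))
    exact f.contMDiff.contMDiffAt.of_le ENat.LEInfty.out

section Bracket

variable {EP : Type*} [NormedAddCommGroup EP] [NormedSpace ℝ EP]
  {HP : Type*} [TopologicalSpace HP] {J : ModelWithCorners ℝ EP HP}
  {P : Type*} [TopologicalSpace P] [ChartedSpace HP P] {pr : P → Q}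

/-- The anchor `V q → T_q Q` in the coordinates of `V` and of `TQ` at `q₀`. -/
noncomputable def anchorCoord (q₀ q : Q) : F →ₗ[ℝ] EQ :=
  (fibreCoord EQ q₀ q : TangentSpace 𝓘(ℝ, EQ) q →L[ℝ] EQ).toLinearMap ∘ₗ 𝔸.anchor q ∘ₗ
    ((trivializationAt F V q₀).symmL ℝ q).toLinearMap

theorem anchorCoord_apply (q₀ q : Q) (z : F) :
    𝔸.anchorCoord q₀ q z =
      fibreCoord EQ q₀ q (𝔸.anchor q ((trivializationAt F V q₀).symmL ℝ q z)) :=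
  rfl

theorem anchorCoord_fibreCoord {q₀ q : Q} (hq : q ∈ (trivializationAt F V q₀).baseSet) (a : V q) :
    𝔸.anchorCoord q₀ q (fibreCoord F q₀ q a) = fibreCoord EQ q₀ q (𝔸.anchor q a) := by
  rw [anchorCoord_apply, symmL_fibreCoord hq]

variable [ContMDiffVectorBundle ∞ F V 𝓘(ℝ, EQ)]

theorem contMDiffAt_anchorCoord {g : P → Q} {z : P → F} {q₀ : Q} {p : P}
    (hg : ContMDiffAt J 𝓘(ℝ, EQ) ∞ g p) (hz : ContMDiffAt J 𝓘(ℝ, F) ∞ z p)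
    (hV : g p ∈ (trivializationAt F V q₀).baseSet) (hT : g p ∈ (chartAt EQ q₀).source) :
    ContMDiffAt J 𝓘(ℝ, EQ) ∞ (fun x ↦ 𝔸.anchorCoord q₀ (g x) (z x)) p := by
  refine (contMDiffAt_totalSpace_iff_fibreCoord (V := TangentSpace 𝓘(ℝ, EQ)) hg hT).1 ?_
  exact 𝔸.contMDiff_anchor.contMDiffAt.comp p (contMDiffAt_totalSpace_symmL hg hz hV)

theorem fibreCoord_flatDeriv (hpr : ContinuousAt pr p) (b : ∀ p, V (pr p)) (v : TangentSpace J p) :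
    fibreCoord F (pr p) (pr p) (flatDeriv (F := F) J pr b p v) =
      mvfderiv J (fun x ↦ fibreCoord F (pr p) (pr x) (b x)) p v := by
  have hself := FiberBundle.mem_baseSet_trivializationAt' (F := F) (E := V) (pr p)
  have hcoord : (fun x ↦ fibreCoord F (pr p) (pr x) (b x)) =ᶠ[𝓝 p]
      fun x ↦ (trivializationAt F V (pr p) ⟨pr x, b x⟩).2 := by
    filter_upwards [eventually_mem_baseSet (F := F) (V := V) hpr] with x hx
    exact fibreCoord_apply hx (b x)
  rw [mvfderiv_congr hcoord]
  exact (congrArg (fibreCoord F (pr p) (pr p)) (Trivialization.symmL_apply _ hself _).symm).trans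
    (fibreCoord_symmL hself _)

variable [FiniteDimensional ℝ EQ] [T2Space Q] [FiniteDimensional ℝ F]

theorem mvfderiv_fibreCoord_anchor {b : ∀ p, V (pr p)} {p : P}
    (hb : ContMDiffAt J (𝓘(ℝ, EQ).prod 𝓘(ℝ, F)) ∞ (fun x ↦ (⟨pr x, b x⟩ : TotalSpace F V)) p)
    (v : TangentSpace J p) :
    mvfderiv J (fun x ↦ fibreCoord EQ (pr p) (pr x) (𝔸.anchor (pr x) (b x))) p v =
      mvfderiv 𝓘(ℝ, EQ)
          (fun q ↦ fibreCoord EQ (pr p) q (𝔸.anchor q (constSection EQ F (b p) q))) (pr p)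
          (mfderiv J 𝓘(ℝ, EQ) pr p v) +
        fibreCoord EQ (pr p) (pr p) (𝔸.anchor (pr p) (flatDeriv (F := F) J pr b p v)) := by
  have hpr : ContMDiffAt J 𝓘(ℝ, EQ) ∞ pr p := (contMDiffAt_totalSpace.1 hb).1
  have hself := FiberBundle.mem_baseSet_trivializationAt' (F := F) (E := V) (pr p)
  have hβ := (contMDiffAt_totalSpace_iff_fibreCoord hpr hself).1 hb
  have hA (z : F) : ContMDiffAt 𝓘(ℝ, EQ) 𝓘(ℝ, EQ) ∞ (fun q ↦ 𝔸.anchorCoord (pr p) q z) (pr p) :=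
    𝔸.contMDiffAt_anchorCoord (g := id) contMDiffAt_id contMDiffAt_const hself
      (mem_chart_source EQ (pr p))
  have hAcoord : (fun x ↦ fibreCoord EQ (pr p) (pr x) (𝔸.anchor (pr x) (b x))) =ᶠ[𝓝 p]
      fun x ↦ 𝔸.anchorCoord (pr p) (pr x) (fibreCoord F (pr p) (pr x) (b x)) := by
    filter_upwards [eventually_mem_baseSet (F := F) (V := V) hpr.continuousAt] with x hx
    exact (𝔸.anchorCoord_fibreCoord hx (b x)).symm
  have hAconst : (fun q ↦ fibreCoord EQ (pr p) q (𝔸.anchor q (constSection EQ F (b p) q)))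
      =ᶠ[𝓝 (pr p)] fun q ↦ 𝔸.anchorCoord (pr p) q (fibreCoord F (pr p) (pr p) (b p)) := by
    filter_upwards [constSection_eventuallyEq (EQ := EQ) (F := F) (b p)] with q hq
    rw [hq, anchorCoord_apply]
  have leibniz := mvfderiv_multilinearMap_apply (ι := Unit)
    (m := fun x ↦ MultilinearMap.ofSubsingleton ℝ F EQ () (𝔸.anchorCoord (pr p) (pr x)))
    (fun z ↦ ((hA (z ())).comp p hpr).mdifferentiableAt (by simp))
    (fun _ ↦ hβ.mdifferentiableAt (by simp)) v
  rw [mvfderiv_congr hAcoord, mvfderiv_congr hAconst, ← 𝔸.anchorCoord_fibreCoord hself,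
    fibreCoord_flatDeriv hpr.continuousAt, ← mvfderiv_comp_mfderiv
      ((hA _).mdifferentiableAt (by simp)) (hpr.mdifferentiableAt (by simp))]
  simpa using leibniz

variable [IsManifold J ∞ P]

variable (J pr) in
/-- Smoothness at `x` of a map `σ` into the total space of the prolongation, which covers
`f : N → P`; the pointwise version of `SmoothAlongOn`. -/
def SmoothAlongAt {EN : Type*} [NormedAddCommGroup EN] [NormedSpace ℝ EN]
    {HN : Type*} [TopologicalSpace HN] (JN : ModelWithCorners ℝ EN HN)
    {N : Type*} [TopologicalSpace N] [ChartedSpace HN N]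
    (f : N → P) (σ : ∀ x : N, 𝔸.Prolongation J pr (f x)) (x : N) : Prop :=
  ContMDiffAt JN (𝓘(ℝ, EQ).prod 𝓘(ℝ, F)) ∞
    (fun x ↦ (⟨pr (f x), (σ x).1.1⟩ : TotalSpace F V)) x ∧
  ContMDiffAt JN J.tangent ∞ (fun x ↦ (⟨f x, (σ x).1.2⟩ : TangentBundle J P)) x

theorem prolongationBracketAux_mem [J.Boundaryless] [CompleteSpace EP]
    {σ τ : ∀ p, 𝔸.Prolongation J pr p} {p : P} (hσ : 𝔸.SmoothAlongAt J pr J id σ p)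
    (hτ : 𝔸.SmoothAlongAt J pr J id τ p) :
    𝔸.prolongationBracketAux J pr σ τ p ∈ 𝔸.Prolongation J pr p := by
  have hpr : ContMDiffAt J 𝓘(ℝ, EQ) ∞ pr p := (contMDiffAt_totalSpace.1 hσ.1).1
  refine fibreCoord_injective (F := EQ) (V := TangentSpace 𝓘(ℝ, EQ)) (mem_chart_source EQ (pr p)) ?_
  have hanchor (υ : ∀ p, 𝔸.Prolongation J pr p) (x : P) :
      𝔸.anchor (pr x) (υ x).1.1 = mfderiv J 𝓘(ℝ, EQ) pr x (υ x).1.2 := (υ x).2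
  have hconst (υ : ∀ p, 𝔸.Prolongation J pr p) :
      𝔸.anchor (pr p) (constSection EQ F (υ p).1.1 (pr p)) =
        mfderiv J 𝓘(ℝ, EQ) pr p (υ p).1.2 := by
    rw [constSection_self, hanchor]
  have hderiv (υ : ∀ p, 𝔸.Prolongation J pr p) (hυ : 𝔸.SmoothAlongAt J pr J id υ p)
      (v : TangentSpace J p) := by
    have h := 𝔸.mvfderiv_fibreCoord_anchor hυ.1 v
    simp only [id_eq, hanchor] at h
    exact h
  have hbracket := fibreCoord_mfderiv_mlieBracket (x := pr p) contMDiffAt_id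
    ((𝔸.contMDiff_anchor_section (constSection EQ F (σ p).1.1)).mdifferentiableAt (by simp))
    ((𝔸.contMDiff_anchor_section (constSection EQ F (τ p).1.1)).mdifferentiableAt (by simp))
  have hpush := fibreCoord_mfderiv_mlieBracket (hpr.of_le ENat.LEInfty.out)
    (hσ.2.mdifferentiableAt (by simp)) (hτ.2.mdifferentiableAt (by simp))
  simp only [mfderiv_id, id_eq, hconst, ContinuousLinearMap.id_apply] at hbracket
  refine Eq.trans ?_ hpush.symm
  rw [hderiv τ hτ, hderiv σ hσ, prolongationBracketAux]
  dsimp only [LinearMap.comp_apply, LinearMap.fst_apply]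
  rw [map_sub, map_add, 𝔸.anchor_bracket, map_sub, map_add]
  refine (congrArg (fun w ↦ w + _ - _) hbracket).trans ?_
  abel

end Bracket

section Frame

variable {EP : Type*} [NormedAddCommGroup EP] [NormedSpace ℝ EP]
  {HP : Type*} [TopologicalSpace HP] {J : ModelWithCorners ℝ EP HP}
  {P : Type*} [TopologicalSpace P] [ChartedSpace HP P] [IsManifold J ∞ P] {pr : P → Q}

/-- The coordinates of an element of the fibre of the prolongation at `p`, given by those of `V`
at `pr p₀` and those of `TP` at `p₀`. They satisfy a linear relation, as the prolongation is a
proper subbundle. -/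
noncomputable def prolongCoord (p₀ p : P) : 𝔸.Prolongation J pr p →ₗ[ℝ] F × EP :=
  ((fibreCoord F (pr p₀) (pr p) : V (pr p) →L[ℝ] F).toLinearMap.prodMap
    (fibreCoord EP p₀ p : TangentSpace J p →L[ℝ] EP).toLinearMap) ∘ₗ
      (𝔸.Prolongation J pr p).subtype

variable (J) in
/-- A smooth family of linear maps `F × EP → 𝒯_p P` for `p` in the neighbourhood `U` of `p₀`, which
recovers an element of `𝒯_p P` from its coordinates. It is an overcomplete substitute for a local
frame: the images of a basis of `F × EP` span `𝒯_p P`, but they are linearly dependent. -/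
structure IsLocalFrame (e : ∀ p, F × EP →ₗ[ℝ] 𝔸.Prolongation J pr p) (p₀ : P) (U : Set P) :
    Prop where
  isOpen : IsOpen U
  mem : p₀ ∈ U
  smooth : ∀ z, 𝔸.SmoothSectionOn J pr (fun p ↦ e p z) U
  apply_prolongCoord : ∀ p ∈ U, ∀ w, e p (𝔸.prolongCoord p₀ p w) = w

/-- The element of `V (pr p) × T_p P` with the coordinates `(z, v)`, where `v` is corrected by means
of `R` so that the element belongs to the prolongation when `R` is a right inverse of
`projCoord`. -/
noncomputable def frameMap (R : EQ →L[ℝ] EP) (p₀ p : P) :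
    F × EP →ₗ[ℝ] V (pr p) × TangentSpace J p :=
  ((trivializationAt F V (pr p₀)).symmL ℝ (pr p)).toLinearMap.prodMap
      ((trivializationAt EP (TangentSpace J) p₀).symmL ℝ p).toLinearMap ∘ₗ
    (LinearMap.fst ℝ F EP).prod (LinearMap.snd ℝ F EP + R.toLinearMap ∘ₗ
      (𝔸.anchorCoord (pr p₀) (pr p) ∘ₗ LinearMap.fst ℝ F EP -
        (projCoord EQ J pr p₀ p).toLinearMap ∘ₗ LinearMap.snd ℝ F EP))

theorem frameMap_mem {R : EQ →L[ℝ] EP} {p₀ p : P} (hp : pr p ∈ (chartAt EQ (pr p₀)).source)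
    (hR : ∀ v, projCoord EQ J pr p₀ p (R v) = v) (z : F × EP) :
    𝔸.frameMap R p₀ p z ∈ 𝔸.Prolongation J pr p := by
  refine fibreCoord_injective (F := EQ) (V := TangentSpace 𝓘(ℝ, EQ)) hp ?_
  have hsolve : 𝔸.anchorCoord (pr p₀) (pr p) z.1 = projCoord EQ J pr p₀ p
      (z.2 + R (𝔸.anchorCoord (pr p₀) (pr p) z.1 - projCoord EQ J pr p₀ p z.2)) := by
    rw [map_add, hR, add_sub_cancel]
  exact hsolve

theorem frameMap_prolongCoord (R : EQ →L[ℝ] EP) {p₀ p : P} (hp : p ∈ coordDomain EQ F V HP pr p₀)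
    (w : 𝔸.Prolongation J pr p) : 𝔸.frameMap R p₀ p (𝔸.prolongCoord p₀ p w) = w.1 := by
  have hrel : 𝔸.anchorCoord (pr p₀) (pr p) (𝔸.prolongCoord p₀ p w).1 =
      projCoord EQ J pr p₀ p (𝔸.prolongCoord p₀ p w).2 :=
    (𝔸.anchorCoord_fibreCoord hp.2.1 w.1.1).trans
      ((congrArg _ w.2).trans (projCoord_fibreCoord hp.1 w.1.2).symm)
  have htangent : (𝔸.frameMap (pr := pr) R p₀ p (𝔸.prolongCoord p₀ p w)).2 =
      (trivializationAt EP (TangentSpace J) p₀).symmL ℝ p (𝔸.prolongCoord p₀ p w).2 := by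
    refine congrArg ((trivializationAt EP (TangentSpace J) p₀).symmL ℝ p) ?_
    simp [hrel]
  exact Prod.ext (symmL_fibreCoord hp.2.1 w.1.1)
    (htangent.trans (symmL_fibreCoord (V := TangentSpace J) hp.1 w.1.2))

theorem exists_isLocalFrame [ContMDiffVectorBundle ∞ F V 𝓘(ℝ, EQ)] [FiniteDimensional ℝ EQ]
    (hpr : ContMDiff J 𝓘(ℝ, EQ) ∞ pr) {p₀ : P}
    (hsurj : Function.Surjective (mfderiv J 𝓘(ℝ, EQ) pr p₀)) :
    ∃ e U, 𝔸.IsLocalFrame J (pr := pr) e p₀ U := by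
  classical
  obtain ⟨U, R, hU, hp₀, hUW, hTR, hR⟩ := exists_contMDiffOn_rightInverse
    (T := projCoord EQ J pr p₀) (isOpen_coordDomain EQ F V HP hpr.continuous p₀)
    (mem_coordDomain_self EQ F V HP pr p₀) (fun v p hp ↦
      (contMDiffAt_projCoord_apply hpr hp.1 hp.2.2 v).contMDiffWithinAt)
    (projCoord_self_surjective hsurj)
  refine ⟨fun p ↦ if h : p ∈ U then (𝔸.frameMap (R p) p₀ p).codRestrict _
    (𝔸.frameMap_mem (hUW h).2.2 (hTR p h)) else 0, U, hU, hp₀, fun z ↦ ⟨fun p hp ↦ ?_,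
      fun p hp ↦ ?_⟩, fun p hp w ↦ ?_⟩
  · refine (contMDiffAt_totalSpace_symmL (z := fun _ ↦ z.1) hpr.contMDiffAt contMDiffAt_const
      (hUW hp).2.1).contMDiffWithinAt.congr (fun x hx ↦ ?_) ?_
    · simp [hx, frameMap]
    · simp [hp, frameMap]
  · have hA := 𝔸.contMDiffAt_anchorCoord (z := fun _ ↦ z.1) hpr.contMDiffAt contMDiffAt_const
      (hUW hp).2.1 (hUW hp).2.2
    have hD := contMDiffAt_projCoord_apply hpr (hUW hp).1 (hUW hp).2.2 z.2
    have hv := (contMDiffAt_const (c := z.2)).add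
      (((hR p hp).contMDiffAt (hU.mem_nhds hp)).clm_apply (hA.sub hD))
    refine (contMDiffAt_totalSpace_symmL contMDiffAt_id hv
      (hUW hp).1).contMDiffWithinAt.congr (fun x hx ↦ ?_) ?_
    · simp [hx, frameMap]
    · simp [hp, frameMap]
  · simp only [dif_pos hp]
    exact Subtype.ext (𝔸.frameMap_prolongCoord (R p) (hUW hp) w)

end Frame

section SmoothSection

variable {EP : Type*} [NormedAddCommGroup EP] [NormedSpace ℝ EP]
  {HP : Type*} [TopologicalSpace HP] {J : ModelWithCorners ℝ EP HP}
  {P : Type*} [TopologicalSpace P] [ChartedSpace HP P] [IsManifold J ∞ P] {pr : P → Q}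
  {EN : Type*} [NormedAddCommGroup EN] [NormedSpace ℝ EN]
  {HN : Type*} [TopologicalSpace HN] {JN : ModelWithCorners ℝ EN HN}
  {N : Type*} [TopologicalSpace N] [ChartedSpace HN N]
  {f : N → P} {σ : ∀ x, 𝔸.Prolongation J pr (f x)} {x : N}

variable {𝔸} in
theorem SmoothAlongOn.smoothAlongAt {U : Set N} (hσ : 𝔸.SmoothAlongOn J pr JN f σ U)
    (hU : U ∈ 𝓝 x) : 𝔸.SmoothAlongAt J pr JN f σ x :=
  ⟨hσ.1.contMDiffAt hU, hσ.2.contMDiffAt hU⟩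

variable [ContMDiffVectorBundle ∞ F V 𝓘(ℝ, EQ)]

variable {𝔸} in
theorem SmoothAlongAt.contMDiffAt_prolongCoord (hσ : 𝔸.SmoothAlongAt J pr JN f σ x) :
    ContMDiffAt JN 𝓘(ℝ, F × EP) ∞ (fun y ↦ 𝔸.prolongCoord (f x) (f y) (σ y)) x :=
  ((contMDiffAt_totalSpace_iff_fibreCoord (contMDiffAt_totalSpace.1 hσ.1).1
    (FiberBundle.mem_baseSet_trivializationAt' (pr (f x)))).1 hσ.1).prodMk_space
  ((contMDiffAt_totalSpace_iff_fibreCoord (contMDiffAt_totalSpace.1 hσ.2).1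
    (mem_chart_source HP (f x))).1 hσ.2)

theorem sectionThrough_spec [FiniteDimensional ℝ EQ] (hpr : ContMDiff J 𝓘(ℝ, EQ) ∞ pr) {p : P}
    (hsurj : Function.Surjective (mfderiv J 𝓘(ℝ, EQ) pr p)) (w : 𝔸.Prolongation J pr p) :
    𝔸.sectionThrough J pr w p = w ∧ 𝔸.SmoothAlongAt J pr J id (𝔸.sectionThrough J pr w) p := by
  have h : ∃ σ : ∀ p' : P, 𝔸.Prolongation J pr p', σ p = w ∧
      ∃ U ∈ 𝓝 p, IsOpen U ∧ 𝔸.SmoothSectionOn J pr σ U := by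
    obtain ⟨e, U, he⟩ := 𝔸.exists_isLocalFrame hpr hsurj
    exact ⟨fun p' ↦ e p' (𝔸.prolongCoord p p w), he.apply_prolongCoord p he.mem w, U,
      he.isOpen.mem_nhds he.mem, he.isOpen, he.smooth _⟩
  rw [sectionThrough, dif_pos h]
  obtain ⟨value_eq, U, hU, -, hsmooth⟩ := h.choose_spec
  exact ⟨value_eq, hsmooth.smoothAlongAt hU⟩

end SmoothSection

section ProlongMap

variable {EP : Type*} [NormedAddCommGroup EP] [NormedSpace ℝ EP]
  {HP : Type*} [TopologicalSpace HP] {J : ModelWithCorners ℝ EP HP}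
  {P : Type*} [TopologicalSpace P] [ChartedSpace HP P]
  {EP' : Type*} [NormedAddCommGroup EP'] [NormedSpace ℝ EP']
  {HP' : Type*} [TopologicalSpace HP'] {J' : ModelWithCorners ℝ EP' HP'}
  {P' : Type*} [TopologicalSpace P'] [ChartedSpace HP' P'] {f : P → P'} {pr' : P' → Q}

/-- The prolongation `(a, v) ↦ (a, Tf v)` of a map `f : P → P'` of fibred manifolds over `Q`. The
projection of `P` is written as `pr' ∘ f`. -/
noncomputable def prolongMap (hpr' : ContMDiff J' 𝓘(ℝ, EQ) ∞ pr') (hf : ContMDiff J J' ∞ f)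
    (p : P) : 𝔸.Prolongation J (pr' ∘ f) p →ₗ[ℝ] 𝔸.Prolongation J' pr' (f p) where
  toFun w := ⟨(w.1.1, mfderiv J J' f p w.1.2), w.2.trans (mfderiv_comp_apply p
    (hpr'.mdifferentiableAt (by simp)) (hf.mdifferentiableAt (by simp)) w.1.2)⟩
  map_add' _ _ := Subtype.ext (Prod.ext rfl (map_add (mfderiv J J' f p) _ _))
  map_smul' _ _ := Subtype.ext (Prod.ext rfl (map_smul (mfderiv J J' f p) _ _))

theorem prolongMap_id (hpr' : ContMDiff J' 𝓘(ℝ, EQ) ∞ pr') (p : P') :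
    𝔸.prolongMap hpr' contMDiff_id p = LinearMap.id :=
  LinearMap.ext fun w ↦ Subtype.ext (Prod.ext rfl
    (congrArg (fun l : EP' →L[ℝ] EP' ↦ l w.1.2) mfderiv_id))

theorem pullbackForm_prolongMap_id (hpr' : ContMDiff J' 𝓘(ℝ, EQ) ∞ pr')
    {k : ℕ} (μ : 𝔸.ProlongationForm J' pr' k) :
    𝔸.pullbackForm (𝔸.prolongMap hpr' contMDiff_id) μ = μ :=
  funext fun p ↦ (congrArg (μ p).compLinearMap (𝔸.prolongMap_id hpr' p)).trans
    (AlternatingMap.compLinearMap_id _)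

variable [IsManifold J ∞ P] [IsManifold J' ∞ P'] {𝔸}

theorem SmoothAlongOn.prolongMap {σ : ∀ p, 𝔸.Prolongation J (pr' ∘ f) p} {U : Set P}
    (hσ : 𝔸.SmoothAlongOn J (pr' ∘ f) J id σ U) (hpr' : ContMDiff J' 𝓘(ℝ, EQ) ∞ pr')
    (hf : ContMDiff J J' ∞ f) :
    𝔸.SmoothAlongOn J' pr' J f (fun p ↦ 𝔸.prolongMap hpr' hf p (σ p)) U :=
  ⟨hσ.1, (hf.contMDiff_tangentMap (m := ∞) (by simp)).comp_contMDiffOn hσ.2⟩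

theorem SmoothAlongAt.prolongMap {σ : ∀ p, 𝔸.Prolongation J (pr' ∘ f) p} {p : P}
    (hσ : 𝔸.SmoothAlongAt J (pr' ∘ f) J id σ p) (hpr' : ContMDiff J' 𝓘(ℝ, EQ) ∞ pr')
    (hf : ContMDiff J J' ∞ f) :
    𝔸.SmoothAlongAt J' pr' J f (fun p ↦ 𝔸.prolongMap hpr' hf p (σ p)) p :=
  ⟨hσ.1, (hf.contMDiff_tangentMap (m := ∞) (by simp)).contMDiffAt.comp p hσ.2⟩

variable [FiniteDimensional ℝ EQ] [T2Space Q] [ContMDiffVectorBundle ∞ F V 𝓘(ℝ, EQ)]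

variable (𝔸) in
/-- The coordinates `C^γ_{αβ} a^α b^β` of the bracket at `q` of the sections through `a` and `b`
which are constant near `q` in the preferred trivialization of `V` at `q`. -/
noncomputable def flatBracketCoord {q : Q} (a b : V q) : F :=
  fibreCoord F q q (𝔸.bracket (constSection EQ F a) (constSection EQ F b) q)

theorem prolongCoord_prolongMap_prolongationBracket [J.Boundaryless] [CompleteSpace EP]
    [FiniteDimensional ℝ F] {σ τ : ∀ p, 𝔸.Prolongation J (pr' ∘ f) p} {p : P}
    (hσ : 𝔸.SmoothAlongAt J (pr' ∘ f) J id σ p) (hτ : 𝔸.SmoothAlongAt J (pr' ∘ f) J id τ p)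
    (hpr' : ContMDiff J' 𝓘(ℝ, EQ) ∞ pr') (hf : ContMDiff J J' ∞ f) :
    𝔸.prolongCoord (f p) (f p)
        (𝔸.prolongMap hpr' hf p (𝔸.prolongationBracket J (pr' ∘ f) σ τ p)) =
      mvfderiv J (fun y ↦ 𝔸.prolongCoord (f p) (f y) (𝔸.prolongMap hpr' hf y (τ y))) p
          (σ p).1.2 -
        mvfderiv J (fun y ↦ 𝔸.prolongCoord (f p) (f y) (𝔸.prolongMap hpr' hf y (σ y))) p
          (τ p).1.2 +
        (𝔸.flatBracketCoord (σ p).1.1 (τ p).1.1, 0) := by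
  have hderiv {υ : ∀ p, 𝔸.Prolongation J (pr' ∘ f) p}
      (hυ : 𝔸.SmoothAlongAt J (pr' ∘ f) J id υ p) (v : TangentSpace J p) :
      mvfderiv J (fun y ↦ 𝔸.prolongCoord (f p) (f y) (𝔸.prolongMap hpr' hf y (υ y))) p v =
        (mvfderiv J (fun y ↦ fibreCoord F (pr' (f p)) (pr' (f y)) (υ y).1.1) p v,
          mvfderiv J (fun y ↦ fibreCoord EP' (f p) (f y) (mfderiv J J' f y (υ y).1.2)) p v) := by
    have hc := ((hυ.prolongMap hpr' hf).contMDiffAt_prolongCoord).mdifferentiableAt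
      (by simp : (∞ : ℕ∞ω) ≠ 0)
    exact mvfderiv_prodMk
      ((ContinuousLinearMap.fst ℝ F EP').mdifferentiableAt.comp p hc)
      ((ContinuousLinearMap.snd ℝ F EP').mdifferentiableAt.comp p hc) v
  have hflat (υ : ∀ p, 𝔸.Prolongation J (pr' ∘ f) p) (v : TangentSpace J p) :=
    fibreCoord_flatDeriv (F := F) (pr := pr' ∘ f) (hpr'.comp hf).continuous.continuousAt
      (fun y ↦ (υ y).1.1) v
  rw [hderiv hσ, hderiv hτ, prolongationBracket, dif_pos (𝔸.prolongationBracketAux_mem hσ hτ)]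
  refine Prod.ext ?_ ?_
  · have hsum (a b c : V (pr' (f p))) : fibreCoord F (pr' (f p)) (pr' (f p)) (a + b - c) =
        fibreCoord F (pr' (f p)) (pr' (f p)) b - fibreCoord F (pr' (f p)) (pr' (f p)) c +
          fibreCoord F (pr' (f p)) (pr' (f p)) a := by
      rw [map_sub, map_add]
      abel
    exact (hsum _ _ _).trans (congrArg₂ (fun y z ↦ y - z + _) (hflat τ _) (hflat σ _))
  · refine Eq.trans ?_ (add_zero _).symm
    exact fibreCoord_mfderiv_mlieBracket (hf.contMDiffAt.of_le ENat.LEInfty.out)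
      (hσ.2.mdifferentiableAt (by simp)) (hτ.2.mdifferentiableAt (by simp))

end ProlongMap

variable [ContMDiffVectorBundle ∞ F V 𝓘(ℝ, EQ)] {𝔸}

section KoszulInFrame

variable {EP : Type*} [NormedAddCommGroup EP] [NormedSpace ℝ EP]
  {HP : Type*} [TopologicalSpace HP] {J : ModelWithCorners ℝ EP HP}
  {P : Type*} [TopologicalSpace P] [ChartedSpace HP P] {pr : P → Q} {k : ℕ}

theorem IsLocalFrame.dirDeriv_form_apply [FiniteDimensional ℝ F] [FiniteDimensional ℝ EP]
    [IsManifold J ∞ P]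
    {EN : Type*} [NormedAddCommGroup EN] [NormedSpace ℝ EN]
    {HN : Type*} [TopologicalSpace HN] {JN : ModelWithCorners ℝ EN HN}
    {N : Type*} [TopologicalSpace N] [ChartedSpace HN N] {f : N → P} {x : N}
    {e : ∀ p, F × EP →ₗ[ℝ] 𝔸.Prolongation J pr p} {U : Set P} {μ : 𝔸.ProlongationForm J pr k}
    {τ : Fin k → ∀ y, 𝔸.Prolongation J pr (f y)} (he : 𝔸.IsLocalFrame J e (f x) U)
    (hμ : 𝔸.SmoothForm J pr μ) (hf : ContMDiffAt JN J ∞ f x)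
    (hτ : ∀ l, 𝔸.SmoothAlongAt J pr JN f (τ l) x) (v : TangentSpace JN x) :
    dirDeriv JN (fun y ↦ μ (f y) fun l ↦ τ l y) x v =
      dirDeriv J (fun p ↦ μ p fun l ↦ e p (𝔸.prolongCoord (f x) (f x) (τ l x))) (f x)
          (mfderiv JN J f x v) +
        ∑ j, μ (f x) (Function.update (fun l ↦ τ l x) j
          (e (f x) (mvfderiv JN (fun y ↦ 𝔸.prolongCoord (f x) (f y) (τ j y)) x v))) := by
  have hU := he.isOpen.mem_nhds he.mem
  have hμe (z : Fin k → F × EP) :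
      ContMDiffAt J 𝓘(ℝ, ℝ) ∞ (fun p ↦ μ p fun l ↦ e p (z l)) (f x) :=
    (hμ U (fun l p ↦ e p (z l)) he.isOpen fun l ↦ he.smooth (z l)).contMDiffAt hU
  have hcoord : (fun y ↦ μ (f y) fun l ↦ τ l y) =ᶠ[𝓝 x]
      fun y ↦ μ (f y) fun l ↦ e (f y) (𝔸.prolongCoord (f x) (f y) (τ l y)) := by
    filter_upwards [hf.continuousAt.preimage_mem_nhds hU] with y hy
    simp only [he.apply_prolongCoord (f y) hy]
  have leibniz := mvfderiv_multilinearMap_apply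
    (m := fun y ↦ ((μ (f y)).compLinearMap (e (f y))).toMultilinearMap)
    (fun z ↦ ((hμe z).comp x hf).mdifferentiableAt (by simp))
    (fun l ↦ (hτ l).contMDiffAt_prolongCoord.mdifferentiableAt (by simp)) v
  refine (mvfderiv_congr hcoord v).trans (leibniz.trans (congrArg₂ (· + ·) ?_ ?_))
  · exact mvfderiv_comp_mfderiv ((hμe _).mdifferentiableAt (by simp))
      (hf.mdifferentiableAt (by simp)) v
  · refine Finset.sum_congr rfl fun j _ ↦ congrArg (μ (f x)) (funext fun l ↦ ?_)
    rcases eq_or_ne l j with rfl | hlj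
    · simp
    · simp [hlj, he.apply_prolongCoord (f x) he.mem]

variable [FiniteDimensional ℝ EQ] [T2Space Q]

theorem bracketTerms_eq_pairSum (μ : 𝔸.ProlongationForm J pr k)
    (σ : Fin (k + 1) → ∀ p, 𝔸.Prolongation J pr p) (p : P) :
    𝔸.bracketTerms J pr μ σ p = pairSum (μ p)
      (fun i j ↦ 𝔸.prolongationBracket J pr (σ i) (σ j) p) fun i ↦ σ i p := by
  cases k <;> rfl

/-- The value of the exterior derivative of `μ` on `w₀, …, wₖ` in the fibre at `p₀`, computed from
the sections with constant coordinates in the frame `e`. Along these the derivative parts of the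
brackets vanish. -/
noncomputable def koszulInFrame [IsManifold J ∞ P] (e : ∀ p, F × EP →ₗ[ℝ] 𝔸.Prolongation J pr p)
    (p₀ : P) (μ : 𝔸.ProlongationForm J pr k)
    (w : Fin (k + 1) → 𝔸.Prolongation J pr p₀) : ℝ :=
  ∑ i : Fin (k + 1), (-1 : ℝ) ^ (i : ℕ) *
      dirDeriv J (fun p ↦ μ p fun l ↦ e p (𝔸.prolongCoord p₀ p₀ (i.removeNth w l))) p₀ (w i).1.2 +
    pairSum (μ p₀) (fun i j ↦ e p₀ (𝔸.flatBracketCoord (w i).1.1 (w j).1.1, 0)) w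

end KoszulInFrame

section Morphism

variable [FiniteDimensional ℝ EQ] [T2Space Q] [FiniteDimensional ℝ F]
  {EP : Type*} [NormedAddCommGroup EP] [NormedSpace ℝ EP] [CompleteSpace EP]
  {HP : Type*} [TopologicalSpace HP] {J : ModelWithCorners ℝ EP HP} [J.Boundaryless]
  {P : Type*} [TopologicalSpace P] [ChartedSpace HP P] [IsManifold J ∞ P]
  {EP' : Type*} [NormedAddCommGroup EP'] [NormedSpace ℝ EP'] [FiniteDimensional ℝ EP']
  {HP' : Type*} [TopologicalSpace HP'] {J' : ModelWithCorners ℝ EP' HP'}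
  {P' : Type*} [TopologicalSpace P'] [ChartedSpace HP' P'] [IsManifold J' ∞ P'] {pr' : P' → Q}
  {f : P → P'} {k : ℕ} {μ : 𝔸.ProlongationForm J' pr' k}

theorem IsLocalFrame.koszul_pullbackForm_prolongMap {p : P} {U : Set P'}
    {e : ∀ p', F × EP' →ₗ[ℝ] 𝔸.Prolongation J' pr' p'}
    {σ : Fin (k + 1) → ∀ p, 𝔸.Prolongation J (pr' ∘ f) p} (he : 𝔸.IsLocalFrame J' e (f p) U)
    (hμ : 𝔸.SmoothForm J' pr' μ) (hpr' : ContMDiff J' 𝓘(ℝ, EQ) ∞ pr') (hf : ContMDiff J J' ∞ f)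
    (hσ : ∀ i, 𝔸.SmoothAlongAt J (pr' ∘ f) J id (σ i) p) :
    𝔸.koszul J (pr' ∘ f) (𝔸.pullbackForm (𝔸.prolongMap hpr' hf) μ) σ p =
      koszulInFrame e (f p) μ fun i ↦ 𝔸.prolongMap hpr' hf p (σ i p) := by
  let c (i : Fin (k + 1)) (y : P) : 𝔸.Prolongation J' pr' (f y) := 𝔸.prolongMap hpr' hf y (σ i y)
  have hc (i) := (hσ i).prolongMap hpr' hf
  let d (i j : Fin (k + 1)) : 𝔸.Prolongation J' pr' (f p) :=
    e (f p) (mvfderiv J (fun y ↦ 𝔸.prolongCoord (f p) (f y) (c j y)) p (σ i p).1.2)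
  have hderiv (i : Fin (k + 1)) :
      dirDeriv J (fun y ↦ 𝔸.pullbackForm (𝔸.prolongMap hpr' hf) μ y
          (i.removeNth fun l ↦ σ l y)) p (σ i p).1.2 =
        dirDeriv J' (fun p' ↦ μ p' fun l ↦ e p' (𝔸.prolongCoord (f p) (f p)
            (i.removeNth (fun l ↦ c l p) l))) (f p) (c i p).1.2 +
          ∑ j, μ (f p) (Function.update (i.removeNth fun l ↦ c l p) j (d i (i.succAbove j))) :=
    he.dirDeriv_form_apply (τ := fun l ↦ c (i.succAbove l)) hμ hf.contMDiffAt (fun l ↦ hc _) _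
  have hbracket (i j : Fin (k + 1)) :
      𝔸.prolongMap hpr' hf p (𝔸.prolongationBracket J (pr' ∘ f) (σ i) (σ j) p) =
        e (f p) (𝔸.flatBracketCoord (σ i p).1.1 (σ j p).1.1, 0) + (d i j - d j i) := by
    rw [← he.apply_prolongCoord (f p) he.mem (𝔸.prolongMap hpr' hf p _),
      prolongCoord_prolongMap_prolongationBracket (hσ i) (hσ j), map_add, map_sub, add_comm]
  have hcancel := sum_update_removeNth_add_pairSum_eq_zero (μ (f p)) d fun i ↦ c i p
  have hpair : 𝔸.bracketTerms J (pr' ∘ f) (𝔸.pullbackForm (𝔸.prolongMap hpr' hf) μ) σ p =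
      pairSum (μ (f p)) (fun i j ↦ e (f p) (𝔸.flatBracketCoord (σ i p).1.1 (σ j p).1.1, 0))
          (fun i ↦ c i p) +
        pairSum (μ (f p)) (fun i j ↦ d i j - d j i) fun i ↦ c i p := by
    rw [bracketTerms_eq_pairSum, pullbackForm, pairSum_compLinearMap, ← pairSum_add]
    simp only [hbracket, c]
  simp only [koszul, hderiv, hpair, mul_add, Finset.sum_add_distrib]
  exact (add_add_add_comm _ _ _ _).trans (add_eq_left.2 hcancel)

theorem extDeriv_pullbackForm_prolongMap [J'.Boundaryless] {p : P}
    (hμ : 𝔸.SmoothForm J' pr' μ) (hpr' : ContMDiff J' 𝓘(ℝ, EQ) ∞ pr') (hf : ContMDiff J J' ∞ f)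
    (hsurj : Function.Surjective (mfderiv J 𝓘(ℝ, EQ) (pr' ∘ f) p))
    (w : Fin (k + 1) → 𝔸.Prolongation J (pr' ∘ f) p) :
    𝔸.extDeriv J (pr' ∘ f) (𝔸.pullbackForm (𝔸.prolongMap hpr' hf) μ) p w =
      𝔸.extDeriv J' pr' μ (f p) fun i ↦ 𝔸.prolongMap hpr' hf p (w i) := by
  have hsurj' : Function.Surjective (mfderiv J' 𝓘(ℝ, EQ) pr' (f p)) := by
    rw [mfderiv_comp p (hpr'.mdifferentiableAt (by simp)) (hf.mdifferentiableAt (by simp))] at hsurj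
    exact Function.Surjective.of_comp hsurj
  obtain ⟨e, U, he⟩ := 𝔸.exists_isLocalFrame hpr' hsurj'
  have hsource (i : Fin (k + 1)) := 𝔸.sectionThrough_spec (hpr'.comp hf) hsurj (w i)
  have htarget (i : Fin (k + 1)) :=
    𝔸.sectionThrough_spec hpr' hsurj' (𝔸.prolongMap hpr' hf p (w i))
  have hkoszul := he.koszul_pullbackForm_prolongMap (f := id) hμ hpr' contMDiff_id
    fun i ↦ (htarget i).2
  rw [pullbackForm_prolongMap_id] at hkoszul
  rw [extDeriv, extDeriv, he.koszul_pullbackForm_prolongMap hμ hpr' hf fun i ↦ (hsource i).2]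
  refine Eq.trans ?_ hkoszul.symm
  exact congrArg (koszulInFrame e (f p) μ) (funext fun i ↦ by
    rw [(hsource i).1, prolongMap_id, LinearMap.id_apply, (htarget i).1])

theorem isLieAlgebroidMorphism_prolongMap [J'.Boundaryless] (hpr' : ContMDiff J' 𝓘(ℝ, EQ) ∞ pr')
    (hf : ContMDiff J J' ∞ f)
    (hsurj : ∀ p, Function.Surjective (mfderiv J 𝓘(ℝ, EQ) (pr' ∘ f) p)) :
    𝔸.IsLieAlgebroidMorphism J (pr' ∘ f) J' pr' f (𝔸.prolongMap hpr' hf) where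
  smooth_base := hf
  smooth_total _ _ _ hσ := hσ.prolongMap hpr' hf
  extDeriv_pullbackForm _ _ hμ p w := extDeriv_pullbackForm_prolongMap hμ hpr' hf (hsurj p) w

end Morphism

end LieAlgebroid

end Algebroid

section Legendre

variable {EQ : Type*} [NormedAddCommGroup EQ] [NormedSpace ℝ EQ]
  {Q : Type*} [TopologicalSpace Q] [ChartedSpace EQ Q]
  {F : Type*} [NormedAddCommGroup F] [NormedSpace ℝ F]
  {V : Q → Type*} [TopologicalSpace (TotalSpace F V)]
  [∀ q, TopologicalSpace (V q)] [FiberBundle F V]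

theorem contMDiff_timesRealProj : ContMDiff (timesRealModel EQ F) 𝓘(ℝ, EQ) ∞ (timesRealProj F V) :=
  (contMDiff_proj V).comp contMDiff_fst

variable [∀ q, AddCommGroup (V q)] [∀ q, Module ℝ (V q)] [VectorBundle ℝ F V]

-- A smooth section of `V` through the given point, at constant `s`, is a right inverse.
theorem surjective_mfderiv_timesRealProj [FiniteDimensional ℝ EQ] [T2Space Q]
    [IsManifold 𝓘(ℝ, EQ) ∞ Q] [ContMDiffVectorBundle ∞ F V 𝓘(ℝ, EQ)] (p : TotalSpace F V × ℝ) :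
    Function.Surjective (mfderiv (timesRealModel EQ F) 𝓘(ℝ, EQ) (timesRealProj F V) p) := by
  let σ (q : Q) : TotalSpace F V × ℝ := (⟨q, constSection EQ F p.1.snd q⟩, p.2)
  have hσ : ContMDiff 𝓘(ℝ, EQ) (timesRealModel EQ F) ∞ σ :=
    (constSection EQ F p.1.snd).contMDiff.prodMk contMDiff_const
  have hσp : σ p.1.proj = p := Prod.ext (by simp [σ, constSection_self]) rfl
  have hcomp := mfderiv_comp (I'' := 𝓘(ℝ, EQ)) (g := timesRealProj F V) p.1.proj
    (contMDiff_timesRealProj.mdifferentiableAt (by simp)) (hσ.mdifferentiableAt (by simp))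
  rw [hσp] at hcomp
  exact fun v ↦ ⟨mfderiv 𝓘(ℝ, EQ) (timesRealModel EQ F) σ p.1.proj v,
    (congrArg (fun l : EQ →L[ℝ] EQ ↦ l v) (hcomp.symm.trans mfderiv_id))⟩

theorem contMDiffOn_dual_apply {EN : Type*} [NormedAddCommGroup EN] [NormedSpace ℝ EN]
    {HN : Type*} [TopologicalSpace HN] {JN : ModelWithCorners ℝ EN HN}
    {N : Type*} [TopologicalSpace N] [ChartedSpace HN N] {g : N → Q}
    {ν : ∀ x, V (g x) →L[ℝ] ℝ} {a : ∀ x, V (g x)} {U : Set N}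
    (hν : ContMDiffOn JN (𝓘(ℝ, EQ).prod 𝓘(ℝ, F →L[ℝ] ℝ)) ∞
      (fun x ↦ (⟨g x, ν x⟩ : TotalSpace (F →L[ℝ] ℝ) (fun q ↦ V q →L[ℝ] ℝ))) U)
    (ha : ContMDiffOn JN (𝓘(ℝ, EQ).prod 𝓘(ℝ, F)) ∞ (fun x ↦ (⟨g x, a x⟩ : TotalSpace F V)) U) :
    ContMDiffOn JN 𝓘(ℝ, ℝ) ∞ (fun x ↦ ν x (a x)) U := fun x hx ↦
  (contMDiffWithinAt_totalSpace.1
    (ContMDiffOn.clm_bundle_apply (E₂ := fun _ : Q ↦ ℝ) (F₂ := ℝ) hν ha x hx)).2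

variable [IsManifold 𝓘(ℝ, EQ) ∞ Q] [ContMDiffVectorBundle ∞ F V 𝓘(ℝ, EQ)] (𝔸 : LieAlgebroid EQ F V)

theorem smoothForm_canonicalContactForm :
    𝔸.SmoothForm (timesRealModel EQ (F →L[ℝ] ℝ))
      (timesRealProj (F →L[ℝ] ℝ) (fun q ↦ V q →L[ℝ] ℝ)) (canonicalContactForm 𝔸) := by
  intro U σ _ hσ
  have smooth_sComponent := contMDiffOn_dirDeriv_vectorField
    (f := (Prod.snd : TotalSpace (F →L[ℝ] ℝ) (fun q ↦ V q →L[ℝ] ℝ) × ℝ → ℝ)) (U := U)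
    contMDiff_snd (hσ 0).2
  have smooth_liouville : ContMDiffOn (timesRealModel EQ (F →L[ℝ] ℝ)) 𝓘(ℝ, ℝ) ∞
      (fun p ↦ p.1.snd (σ 0 p).1.1) U :=
    contMDiffOn_dual_apply (EQ := EQ) (F := F) (V := V)
      (g := fun p : TotalSpace (F →L[ℝ] ℝ) (fun q ↦ V q →L[ℝ] ℝ) × ℝ ↦ p.1.proj)
      (ν := fun p ↦ p.1.snd) (a := fun p ↦ (σ 0 p).1.1) contMDiff_fst.contMDiffOn (hσ 0).1
  exact smooth_sComponent.sub smooth_liouville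

variable [∀ q, IsTopologicalAddGroup (V q)] [∀ q, ContinuousSMul ℝ (V q)]
  (L : C^∞⟮timesRealModel EQ F, TotalSpace F V × ℝ; ℝ⟯)

theorem sComponent_prolongedLegendre (p : TotalSpace F V × ℝ)
    (w : 𝔸.Prolongation (timesRealModel EQ F) (timesRealProj F V) p) :
    sComponent 𝔸 (legendre L p) (prolongedLegendre L 𝔸 p w) = sComponent 𝔸 p w :=
  (mfderiv_comp_apply p (I'' := 𝓘(ℝ, ℝ))
    (g := (Prod.snd : TotalSpace (F →L[ℝ] ℝ) (fun q ↦ V q →L[ℝ] ℝ) × ℝ → ℝ))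
    mdifferentiableAt_snd ((contMDiff_legendre L).mdifferentiableAt (by simp)) w.1.2).symm

-- Both sides are the derivative of `t ↦ L (b + t a, s)` at `0`.
theorem liouville_prolongedLegendre (p : TotalSpace F V × ℝ)
    (w : 𝔸.Prolongation (timesRealModel EQ F) (timesRealProj F V) p) :
    liouville 𝔸 (legendre L p) (prolongedLegendre L 𝔸 p w) = poincareCartan L 𝔸 p w :=
  (deriv_fibre_curve L p w.1.1).trans
    (congrArg (mfderiv (timesRealModel EQ F) 𝓘(ℝ, ℝ) L p) (mfderiv_fibre_curve p w.1.1).symm)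

theorem pullbackForm_canonicalContactForm :
    𝔸.pullbackForm (prolongedLegendre L 𝔸) (canonicalContactForm 𝔸) =
      lagrangianContactForm L 𝔸 := by
  funext p
  ext w
  exact congrArg₂ (· - ·) (sComponent_prolongedLegendre 𝔸 L p (w 0))
    (liouville_prolongedLegendre 𝔸 L p (w 0))

variable [FiniteDimensional ℝ F] [FiniteDimensional ℝ EQ] [T2Space Q]

theorem isLieAlgebroidMorphism_prolongedLegendre :
    𝔸.IsLieAlgebroidMorphism (timesRealModel EQ F) (timesRealProj F V)
      (timesRealModel EQ (F →L[ℝ] ℝ)) (timesRealProj (F →L[ℝ] ℝ) (fun q ↦ V q →L[ℝ] ℝ))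
      (legendre L) (prolongedLegendre L 𝔸) :=
  LieAlgebroid.isLieAlgebroidMorphism_prolongMap contMDiff_timesRealProj (contMDiff_legendre L)
    surjective_mfderiv_timesRealProj

end Legendre

theorem mainTheorem3_general {EQ : Type*} [NormedAddCommGroup EQ] [NormedSpace ℝ EQ]
    [FiniteDimensional ℝ EQ]
    {Q : Type*} [TopologicalSpace Q] [T2Space Q] [ChartedSpace EQ Q] [IsManifold 𝓘(ℝ, EQ) ∞ Q]
    {F : Type*} [NormedAddCommGroup F] [NormedSpace ℝ F] [FiniteDimensional ℝ F]
    {V : Q → Type*} [TopologicalSpace (TotalSpace F V)] [∀ q, AddCommGroup (V q)]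
    [∀ q, Module ℝ (V q)] [∀ q, TopologicalSpace (V q)] [∀ q, IsTopologicalAddGroup (V q)]
    [∀ q, ContinuousSMul ℝ (V q)] [FiberBundle F V] [VectorBundle ℝ F V]
    [ContMDiffVectorBundle ∞ F V 𝓘(ℝ, EQ)]
    (𝔸 : LieAlgebroid EQ F V) (L : C^∞⟮timesRealModel EQ F, TotalSpace F V × ℝ; ℝ⟯) :
    𝔸.IsLieAlgebroidMorphism (timesRealModel EQ F) (timesRealProj F V)
        (timesRealModel EQ (F →L[ℝ] ℝ)) (timesRealProj (F →L[ℝ] ℝ) (fun q ↦ V q →L[ℝ] ℝ))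
        (legendre L) (prolongedLegendre L 𝔸) ∧
      𝔸.pullbackForm (prolongedLegendre L 𝔸) (canonicalContactForm 𝔸) =
        lagrangianContactForm L 𝔸 ∧
      ∀ (p : TotalSpace F V × ℝ)
        (w : Fin 2 → 𝔸.Prolongation (timesRealModel EQ F) (timesRealProj F V) p),
        𝔸.extDeriv (timesRealModel EQ (F →L[ℝ] ℝ))
            (timesRealProj (F →L[ℝ] ℝ) (fun q ↦ V q →L[ℝ] ℝ)) (canonicalContactForm 𝔸)
            (legendre L p) (fun i ↦ prolongedLegendre L 𝔸 p (w i)) =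
          𝔸.extDeriv (timesRealModel EQ F) (timesRealProj F V) (lagrangianContactForm L 𝔸) p w :=
  have h := isLieAlgebroidMorphism_prolongedLegendre 𝔸 L
  ⟨h, pullbackForm_canonicalContactForm 𝔸 L, fun p w ↦ by
    rw [← h.extDeriv_pullbackForm _ _ (smoothForm_canonicalContactForm 𝔸),
      pullbackForm_canonicalContactForm]⟩

theorem mainTheorem3 {EQ : Type*} [NormedAddCommGroup EQ] [NormedSpace ℝ EQ]
    [FiniteDimensional ℝ EQ]
    {Q : Type*} [TopologicalSpace Q] [T2Space Q] [ChartedSpace EQ Q] [IsManifold 𝓘(ℝ, EQ) ∞ Q]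
    {F : Type*} [NormedAddCommGroup F] [NormedSpace ℝ F] [FiniteDimensional ℝ F]
    {V : Q → Type*} [TopologicalSpace (TotalSpace F V)] [∀ q, AddCommGroup (V q)]
    [∀ q, Module ℝ (V q)] [∀ q, TopologicalSpace (V q)] [∀ q, IsTopologicalAddGroup (V q)]
    [∀ q, ContinuousSMul ℝ (V q)] [FiberBundle F V] [VectorBundle ℝ F V]
    [ContMDiffVectorBundle ∞ F V 𝓘(ℝ, EQ)]
    (𝔸 : LieAlgebroid EQ F V) (L : C^∞⟮timesRealModel EQ F, TotalSpace F V × ℝ; ℝ⟯)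
    (hL : IsRegularLagrangian L) :
    𝔸.IsLieAlgebroidMorphism (timesRealModel EQ F) (timesRealProj F V)
        (timesRealModel EQ (F →L[ℝ] ℝ)) (timesRealProj (F →L[ℝ] ℝ) (fun q ↦ V q →L[ℝ] ℝ))
        (legendre L) (prolongedLegendre L 𝔸) ∧
      𝔸.pullbackForm (prolongedLegendre L 𝔸) (canonicalContactForm 𝔸) =
        lagrangianContactForm L 𝔸 ∧
      ∀ (p : TotalSpace F V × ℝ)
        (w : Fin 2 → 𝔸.Prolongation (timesRealModel EQ F) (timesRealProj F V) p),
        𝔸.extDeriv (timesRealModel EQ (F →L[ℝ] ℝ))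
            (timesRealProj (F →L[ℝ] ℝ) (fun q ↦ V q →L[ℝ] ℝ)) (canonicalContactForm 𝔸)
            (legendre L p) (fun i ↦ prolongedLegendre L 𝔸 p (w i)) =
          𝔸.extDeriv (timesRealModel EQ F) (timesRealProj F V) (lagrangianContactForm L 𝔸) p w :=
  mainTheorem3_general 𝔸 L
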